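/- Let $D\ge 1$ be an integer, $\lambda>1$ and $0<\alpha\le\beta\le 1$. For $n\ge 0$ put $s_n=\lambda^{-n\beta/D}$. Let $T_n$ ($n\ge0$) and $V_{n,k}$ ($n\ge 0$, $k\in\mathbb Z^D$) be mutually independent random vectors, where $T_n$ and every $V_{n,k}$ are uniformly distributed in the cube $s_n(0,1)^D$. The mesh $s_n\mathbb Z^D$ is translated by $T_n$, and in each cube $C_{n,k}=T_n+s_nk+s_n[0,1]^D$ of the translated mesh one takes the uniform random nucleus $c_{n,k}=T_n+s_nk+V_{n,k}$. Let $\Delta_n:\mathbb R^D\to[0,1]$ be the random pyramidal function that vanishes on the boundaries of all cubes $C_{n,k}$, equals $1$ at all nuclei $c_{n,k}$, and is affine on the convex hull of $\{c_{n,k}\}\cup f$ for every hyperface $f$ of $C_{n,k}$. Put $$F(x)=\sum_{n=0}^\infty \lambda^{-n\alpha/D}\,\Delta_n(x),\qquad \Gamma=\{(x,F(x)):x\in[0,1]^D\}\subset\mathbb R^D\times\mathbb R .$$ (For $\lambda=2^{D/\beta}$ these are the dyadic meshes $2^{-n}\mathbb Z^D$ with amplitudes $2^{-n\alpha/\beta}$;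 for $\lambda=2$ they are the meshes of side $2^{-n\beta/D}$ with amplitudes $2^{-n\alpha/D}$.) Let $\dim_B$ denote the upper box dimension and $\dim_H$ the Hausdorff dimension. Then almost surely: (i) if $D\ge2$, then $\dim_B\Gamma\le D+1-\frac{\alpha}{\beta}$; (ii) if $D=1$, then $\dim_B\Gamma=\dim_H\Gamma=2-\frac{\alpha}{\beta}$. -/

import Mathlib

noncomputable section

namespace TakagiKnopp

/-- The space `ℝ^D` with its Euclidean norm. -/
abbrev Space (D : ℕ) : Type := EuclideanSpace ℝ (Fin D)

/-- The open cube `s (0,1)^D`. -/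
def openCube (D : ℕ) (s : ℝ) : Set (Space D) := {x | ∀ i, 0 < x i ∧ x i < s}

/-- The closed unit cube `[0,1]^D`. -/
def unitCube (D : ℕ) : Set (Space D) := {x | ∀ i, 0 ≤ x i ∧ x i ≤ 1}

/-- The side length `lam^(-nβ/D)` of the cubes of the mesh of generation `n`. -/
def meshSide (D : ℕ) (lam β : ℝ) (n : ℕ) : ℝ := lam ^ (-(n * β / D))

/-- The index `k ∈ ℤ^D` of the (half-open) cube `t + s (k + [0,1)^D)` of the translate by `t` of
the mesh `s ℤ^D` that contains `x`. -/
def cubeIndex {D : ℕ} (s : ℝ) (t x : Space D) : Fin D → ℤ := fun i => ⌊(x i - t i) / s⌋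

/-- The lower corner `t + s k` of the cube of index `k`. -/
def cubeCorner {D : ℕ} (s : ℝ) (t : Space D) (k : Fin D → ℤ) : Space D :=
  WithLp.toLp 2 (fun i => t i + s * k i)

/-- The pyramid with apex above `c` (an interior point) and with base the cube `a + [0,s]^D`: the
minimum, over the `2 D` hyperfaces `f` of the cube, of the affine function that vanishes on `f` and
equals `1` at `c`. On the cube this is the function that vanishes on the boundary, equals `1` at `c`
and is affine on the convex hull of `{c} ∪ f` for every hyperface `f`, namely
`(1 - u) c + u y ↦ 1 - u` for `y` in the boundary and `u ∈ [0,1]`. -/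
def cubePyramid {D : ℕ} (a : Space D) (s : ℝ) (c x : Space D) : ℝ :=
  ⨅ i, min ((x i - a i) / (c i - a i)) ((a i + s - x i) / (a i + s - c i))

/-- The pyramidal function over the mesh `s ℤ^D` translated by `t`, where the nucleus of the cube
of index `k` is the point `t + s k + v k`. -/
def layer {D : ℕ} (s : ℝ) (t : Space D) (v : (Fin D → ℤ) → Space D) (x : Space D) : ℝ :=
  cubePyramid (cubeCorner s t (cubeIndex s t x)) s
    (cubeCorner s t (cubeIndex s t x) + v (cubeIndex s t x)) x

/-- The series `∑ lam^(-nα/D) Δ_n`, where `Δ_n` is the pyramidal function over the mesh of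
generation `n` translated by `t n`, with nuclei at position `v n k` relative to the lower corner of
the cube of index `k`. -/
def series {D : ℕ} (lam α β : ℝ) (t : ℕ → Space D) (v : ℕ → (Fin D → ℤ) → Space D)
    (x : Space D) : ℝ :=
  ∑' n : ℕ, lam ^ (-(n * α / D)) * layer (meshSide D lam β n) (t n) (v n) x

/-- The graph of `f` above `[0,1]^D`, in `ℝ^D × ℝ` with the Euclidean distance. -/
def graphOnCube {D : ℕ} (f : Space D → ℝ) : Set (WithLp 2 (Space D × ℝ)) :=
  (fun x => WithLp.toLp 2 (x, f x)) '' unitCube D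

/-- The upper box dimension: the upper limit, as `ε → 0+`, of `log N(ε) / (-log ε)`, where `N(ε)` is
the least number of closed balls of radius `ε`, centred in `A`, that cover `A`. -/
def upperBoxDim {X : Type*} [PseudoEMetricSpace X] (A : Set X) : EReal :=
  Filter.limsup
    (fun ε : NNReal => ENNReal.log (Metric.coveringNumber ε A : ENNReal)
      / ((-Real.log (ε : ℝ) : ℝ) : EReal))
    (nhdsWithin 0 (Set.Ioi 0))

end TakagiKnopp

end

noncomputable section

open MeasureTheory Filter Topology Set ProbabilityTheory
open scoped ENNReal NNReal

namespace TakagiKnopp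

/-! Upper bound, for almost every outcome. Cut the unit cube into cubes of side `1/N`. Nuclei may
lie arbitrarily close to cell boundaries, so the layers have no uniform Lipschitz constant. Along a
line, however, the variation of one layer is `O(1/s)`, wherever the nuclei are. Summed over all grid
lines, the oscillations of layer `n` total at most `(N+1)^D * min 1 (11 * D / (N * s_n))`
(`sum_gridControl_le`). The inequality `min 1 X ≤ X^θ` with `θ < α/β` makes the sum over `n`
geometric (`sum_seriesControl_le`). Counting boxes of height `1/N` above each cube then gives
`O(N^(D+1-θ))` boxes.

Lower bound, `D = 1`. Put `γ = α/β`. Given `x ≠ y`, pick the first scales with `s_n ≤ |x - y|`, so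
that `x` and `y` lie in different cells of generation `n`. Freeze every variable except the nucleus
of the cell of `x`: then `F x - F y` is a tent height, scaled by the amplitude, plus a constant.
Integrating over the nucleus bounds the mean of `|F x - F y|^(-θ)`, up to a factor that is singular
when `x` is near a cell boundary; averaging over the translation `T n` removes that factor. Hence
the mean is `O(|x - y|^(-γθ))` for every `θ < 1` (`exists_lintegral_series_sub_rpow_le_abs_sub`).
The lift of Lebesgue measure to the graph thus has finite mean energy of order `θ + 1 - γ`, and the
energy criterion gives dimension at least `θ + 1 - γ` almost surely. Let `θ → 1`; the equalities
follow from `dimH ≤ upperBoxDim`. -/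

/-! ### Box counting and its comparison with Hausdorff dimension -/

theorem log_div_neg_log_le_iff {ε : ℝ} (h0 : 0 < ε) (h1 : ε < 1) (d : ℝ) (N : ℝ≥0∞) :
    ENNReal.log N / ((-Real.log ε : ℝ) : EReal) ≤ (d : EReal)
      ↔ N ≤ ENNReal.ofReal (ε ^ (-d)) := by
  have hl : 0 < -Real.log ε := by linarith [Real.log_neg h0 h1]
  rw [EReal.div_le_iff_le_mul (by exact_mod_cast hl) (EReal.coe_ne_top _), ← EReal.coe_mul,
    ← ENNReal.log_le_log_iff, ENNReal.log_ofReal_of_pos (Real.rpow_pos_of_pos h0 _),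
    Real.log_rpow h0]
  ring_nf

/-- The radii `K/N` suffice: for small `ε`, `N = ⌈K/ε⌉` gives `K/N ≤ ε` and `N ≤ 2K/ε`, and for any
`d > p` the factor `ε^(d-p)` absorbs the constants. -/
theorem upperBoxDim_le_of_coveringNumber_le {X : Type*} [PseudoEMetricSpace X] {A : Set X}
    {K : ℝ≥0} (hK : 0 < K) {C p : ℝ} (hC : 0 ≤ C) (hp : 0 ≤ p)
    (h : ∀ N : ℕ, 1 ≤ N →
      (Metric.coveringNumber (K / N) A : ℝ≥0∞) ≤ ENNReal.ofReal (C * (N : ℝ) ^ p)) :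
    upperBoxDim A ≤ (p : EReal) := by
  refine EReal.le_of_forall_lt_iff_le.1 fun d hd => ?_
  have hd : p < d := by exact_mod_cast hd
  have hlim : Tendsto (fun ε : ℝ≥0 => C * (2 * (K : ℝ)) ^ p * (ε : ℝ) ^ (d - p)) (𝓝[>] 0) (𝓝 0) := by
    have h1 : Tendsto (fun ε : ℝ≥0 => (ε : ℝ)) (𝓝[>] 0) (𝓝 0) :=
      (NNReal.continuous_coe.tendsto' 0 0 rfl).mono_left nhdsWithin_le_nhds
    have h2 : Tendsto (fun x : ℝ => x ^ (d - p)) (𝓝 0) (𝓝 0) := by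
      have := (Real.continuousAt_rpow_const 0 (d - p) (Or.inr (by linarith))).tendsto
      rwa [Real.zero_rpow (by linarith)] at this
    simpa using (h2.comp h1).const_mul (C * (2 * (K : ℝ)) ^ p)
  have hsmall : ∀ᶠ ε : ℝ≥0 in 𝓝[>] 0, ε < min 1 K :=
    mem_nhdsWithin_of_mem_nhds (Iio_mem_nhds (by positivity))
  refine limsup_le_of_le (by isBoundedDefault) ?_
  filter_upwards [hsmall, self_mem_nhdsWithin, hlim.eventually (Iio_mem_nhds one_pos)]
    with ε hε hpos hlt
  have hpos : (0 : ℝ) < ε := by exact_mod_cast hpos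
  have hKr : (0 : ℝ) < K := by exact_mod_cast hK
  have hε1 : (ε : ℝ) < 1 := by exact_mod_cast hε.trans_le (min_le_left _ _)
  have hεK : (ε : ℝ) < K := by exact_mod_cast hε.trans_le (min_le_right _ _)
  rw [log_div_neg_log_le_iff hpos hε1]
  set N := ⌈(K : ℝ) / ε⌉₊ with hN
  have hN1 : (K : ℝ) / ε ≤ N := Nat.le_ceil _
  have hone : 1 < (K : ℝ) / ε := (one_lt_div hpos).2 hεK
  have hN2 : (N : ℝ) ≤ 2 * K / ε := by
    have := Nat.ceil_lt_add_one (a := (K : ℝ) / ε) (by positivity)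
    rw [mul_div_assoc]; linarith
  have hNpos : (0 : ℝ) < N := by linarith
  have hle : K / N ≤ ε := by
    rw [← NNReal.coe_le_coe]; push_cast
    rw [div_le_iff₀ hNpos]; rw [div_le_iff₀ hpos] at hN1; linarith
  calc (Metric.coveringNumber ε A : ℝ≥0∞) ≤ Metric.coveringNumber (K / N) A := by
        exact_mod_cast Metric.coveringNumber_anti hle
    _ ≤ ENNReal.ofReal (C * (N : ℝ) ^ p) := h N (by exact_mod_cast hNpos)
    _ ≤ _ := by
      refine ENNReal.ofReal_le_ofReal ?_
      calc C * (N : ℝ) ^ p ≤ C * (2 * K / ε) ^ p := by gcongr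
        _ = (C * (2 * (K : ℝ)) ^ p * (ε : ℝ) ^ (d - p)) * (ε : ℝ) ^ (-d) := by
          rw [Real.div_rpow (by positivity) hpos.le, Real.rpow_sub hpos, Real.rpow_neg hpos.le]
          field_simp
        _ ≤ 1 * (ε : ℝ) ^ (-d) := by gcongr
        _ = _ := one_mul _

/-- For `d` above the box dimension, a minimal cover by `ε`-balls has at most `ε^(-d)` members of
diameter at most `2ε`, so the `d`-dimensional Hausdorff measure is at most `2^d`. -/
theorem dimH_le_upperBoxDim {X : Type*} [EMetricSpace X] {A : Set X} (hA : A.Nonempty) :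
    ((dimH A : ℝ≥0∞) : EReal) ≤ upperBoxDim A := by
  refine EReal.le_of_forall_lt_iff_le.1 fun d hd => ?_
  have hev : ∀ᶠ ε : ℝ≥0 in 𝓝[>] 0,
      (Metric.coveringNumber ε A : ℝ≥0∞) ≤ ENNReal.ofReal ((ε : ℝ) ^ (-d)) := by
    have hsmall : ∀ᶠ ε : ℝ≥0 in 𝓝[>] 0, ε < 1 :=
      mem_nhdsWithin_of_mem_nhds (Iio_mem_nhds (by positivity))
    filter_upwards [eventually_lt_of_limsup_lt hd (by isBoundedDefault), hsmall,
      self_mem_nhdsWithin] with ε hε h1 hpos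
    exact (log_div_neg_log_le_iff (by exact_mod_cast hpos) (by exact_mod_cast h1) d _).1 hε.le
  have hsmall : ∀ᶠ ε : ℝ≥0 in 𝓝[>] 0, ε < 1 :=
    mem_nhdsWithin_of_mem_nhds (Iio_mem_nhds (by positivity))
  -- A nonempty set needs at least one ball, which rules out `ε^(-d) < 1`.
  have hd0 : 0 ≤ d := by
    obtain ⟨ε, h1, h2, h3⟩ := (hev.and (hsmall.and self_mem_nhdsWithin)).exists
    by_contra! hneg
    have hlt : (ε : ℝ) ^ (-d) < 1 :=
      Real.rpow_lt_one ε.2 (by exact_mod_cast h2) (by linarith)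
    have : (1 : ℝ≥0∞) ≤ Metric.coveringNumber ε A := by
      exact_mod_cast Order.one_le_iff_pos.2 (Metric.coveringNumber_pos_iff.2 hA)
    have := this.trans h1
    rw [ENNReal.one_le_ofReal] at this
    linarith
  lift d to ℝ≥0 using hd0
  borelize X
  have hcount : ∀ ε : ℝ≥0, Countable (Metric.minimalCover ε A) := fun ε =>
    Metric.finite_minimalCover.countable.to_subtype
  have key : μH[(d : ℝ)] A ≤ 2 ^ (d : ℝ) := by
    refine (Measure.hausdorffMeasure_le_liminf_tsum (l := 𝓝[>] (0 : ℝ≥0))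
      (ι := fun ε : ℝ≥0 => Metric.minimalCover ε A) (d : ℝ) A
      (fun ε : ℝ≥0 => 2 * (ε : ℝ≥0∞)) ?_
      (fun ε i => Metric.closedEBall (i : X) ε) ?_ ?_).trans ?_
    · have : Tendsto (fun ε : ℝ≥0 => 2 * (ε : ℝ≥0∞)) (𝓝 0) (𝓝 (2 * (0 : ℝ≥0))) :=
        ENNReal.Tendsto.const_mul (ENNReal.continuous_coe.tendsto 0) (Or.inr (by simp))
      simpa using this.mono_left nhdsWithin_le_nhds
    · exact Eventually.of_forall fun ε i => Metric.ediam_closedEBall_le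
    · filter_upwards [hev] with ε hε
      have hne : Metric.coveringNumber ε A ≠ ⊤ := fun h => by
        rw [h] at hε; simp at hε
      have := Metric.isCover_iff_subset_iUnion_closedEBall.1 (Metric.isCover_minimalCover hne)
      rwa [biUnion_eq_iUnion] at this
    · refine liminf_le_of_frequently_le' (Eventually.frequently ?_)
      filter_upwards [hev, self_mem_nhdsWithin] with ε hε hpos
      have hpos : (0 : ℝ) < ε := by exact_mod_cast hpos
      have hne : Metric.coveringNumber ε A ≠ ⊤ := fun h => by
        rw [h] at hε; simp at hε
      calc ∑' i : Metric.minimalCover ε A, Metric.ediam (Metric.closedEBall (i : X) ε) ^ (d : ℝ)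
          ≤ ∑' _ : Metric.minimalCover ε A, (2 * (ε : ℝ≥0∞)) ^ (d : ℝ) := by
            refine ENNReal.tsum_le_tsum fun i => ?_
            gcongr
            exact Metric.ediam_closedEBall_le
        _ = Metric.coveringNumber ε A * (2 * (ε : ℝ≥0∞)) ^ (d : ℝ) := by
            rw [ENNReal.tsum_set_const, Metric.encard_minimalCover hne]
        _ ≤ ENNReal.ofReal ((ε : ℝ) ^ (-(d : ℝ))) * (2 * (ε : ℝ≥0∞)) ^ (d : ℝ) := by gcongr
        _ = 2 ^ (d : ℝ) := by
            rw [ENNReal.mul_rpow_of_nonneg _ _ d.coe_nonneg, ← ENNReal.ofReal_coe_nnreal (p := ε),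
              ← ENNReal.ofReal_rpow_of_pos hpos, mul_left_comm,
              ← ENNReal.rpow_add _ _ (by simpa using (NNReal.coe_pos.1 hpos).ne') (by simp)]
            simp
  have := dimH_le_of_hausdorffMeasure_ne_top (s := A) (d := d)
    (key.trans_lt (ENNReal.rpow_lt_top_of_nonneg d.coe_nonneg (by simp))).ne
  calc ((dimH A : ℝ≥0∞) : EReal) ≤ ((d : ℝ≥0∞) : EReal) := by
        exact EReal.coe_ennreal_le_coe_ennreal_iff.2 this
    _ = _ := rfl

/-- The centres of a cover must lie in `A`, so one representative in `A` is chosen from each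
nonempty fibre of `φ`. -/
theorem coveringNumber_le_card {X ι : Type*} [PseudoEMetricSpace X] {A : Set X} {ε : ℝ≥0}
    (φ : X → ι) (S : Finset ι) (hS : ∀ x ∈ A, φ x ∈ S)
    (h : ∀ x ∈ A, ∀ y ∈ A, φ x = φ y → edist x y ≤ ε) :
    Metric.coveringNumber ε A ≤ S.card := by
  have hrep : ∀ i : φ '' A, ∃ x ∈ A, φ x = i := fun i => i.2
  choose rep hrepA hrep using hrep
  have hcov : Metric.IsCover ε A (range rep) := fun x hx =>
    ⟨rep ⟨φ x, mem_image_of_mem φ hx⟩, mem_range_self _, h x hx _ (hrepA _)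
      (hrep ⟨φ x, mem_image_of_mem φ hx⟩).symm⟩
  calc Metric.coveringNumber ε A ≤ (range rep).encard :=
        hcov.coveringNumber_le_encard (range_subset_iff.2 hrepA)
    _ ≤ (φ '' A).encard := by
        rw [← image_univ]
        exact (encard_image_le _ _).trans_eq (encard_univ _)
    _ ≤ (S : Set ι).encard := encard_le_encard (image_subset_iff.2 hS)
    _ = S.card := encard_coe_eq_coe_finsetCard S

/-! ### The energy criterion for lower bounds of Hausdorff dimension -/

/-- Finite energy makes the potential `φ` finite almost everywhere, hence bounded by some `M` on a
set `G` of positive measure. A set `U` whose closure meets `g '' G` has mass at most `M * diam U ^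
s`, since the potential at a point of `G` sees all of that mass at distance at most `diam U`. The
mass distribution principle applies to the image of `ν` restricted to `G`. -/
theorem le_dimH_image_of_energy_lt_top {X Y : Type*} [MeasurableSpace Y] {ν : Measure Y}
    [IsFiniteMeasure ν] [EMetricSpace X] [MeasurableSpace X] [BorelSpace X]
    [SecondCountableTopology X] {g : Y → X} (hg : Measurable g) {B : Set Y} (hB : ν Bᶜ = 0)
    (hν : ν ≠ 0) {s : ℝ≥0} (hs : 0 < s)
    (hE : ∫⁻ x, ∫⁻ y, edist (g x) (g y) ^ (-(s : ℝ)) ∂ν ∂ν < ∞) :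
    (s : ℝ≥0∞) ≤ dimH (g '' B) := by
  set φ : Y → ℝ≥0∞ := fun x => ∫⁻ y, edist (g x) (g y) ^ (-(s : ℝ)) ∂ν with hφ
  have hmeas : Measurable φ :=
    Measurable.lintegral_prod_right' (f := fun p : Y × Y => edist (g p.1) (g p.2) ^ (-(s : ℝ)))
      (((hg.comp measurable_fst).edist (hg.comp measurable_snd)).pow_const _)
  have hfin : ∀ᵐ x ∂ν, φ x < ∞ := ae_lt_top hmeas hE.ne
  obtain ⟨M, hMp, hM⟩ : ∃ M : ℕ, 0 < M ∧ ν {x | φ x ≤ M} ≠ 0 := by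
    by_contra! hzero
    refine hν (Measure.measure_univ_eq_zero.1 ?_)
    have hU : ν (⋃ M : ℕ, {x | φ x ≤ (M + 1 : ℕ)}) = 0 :=
      measure_iUnion_null fun M => hzero (M + 1) M.succ_pos
    refine measure_mono_null (t := (⋃ M : ℕ, {x | φ x ≤ (M + 1 : ℕ)}) ∪ {x | ¬ φ x < ∞}) ?_
      (measure_union_null hU hfin)
    intro x _
    by_cases hx : φ x < ∞
    · obtain ⟨n, hn⟩ := ENNReal.exists_nat_gt hx.ne
      exact Or.inl (mem_iUnion.2 ⟨n, hn.le.trans (by gcongr; simp)⟩)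
    · exact Or.inr hx
  set G := {x | φ x ≤ M} with hG
  have hGm : MeasurableSet G := measurableSet_le hmeas measurable_const
  have hball : ∀ U : Set X, (ν.restrict G).map g U ≤ (M : ℝ≥0∞) * Metric.ediam U ^ (s : ℝ) := by
    intro U
    -- Passing to the closure gives measurability without changing the diameter.
    have hcl : MeasurableSet (closure U) := isClosed_closure.measurableSet
    refine (measure_mono subset_closure).trans ?_
    rw [Measure.map_apply hg hcl, Measure.restrict_apply (hg hcl), ← Metric.ediam_closure U]
    rcases (g ⁻¹' closure U ∩ G).eq_empty_or_nonempty with he | ⟨x, hxU, hxG⟩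
    · simp [he]
    set d := Metric.ediam (closure U) with hd
    have h1 : d ^ (-(s : ℝ)) * ν (g ⁻¹' closure U) ≤ M :=
      calc d ^ (-(s : ℝ)) * ν (g ⁻¹' closure U)
          = ∫⁻ _ in g ⁻¹' closure U, d ^ (-(s : ℝ)) ∂ν := (setLIntegral_const _ _).symm
        _ ≤ ∫⁻ y in g ⁻¹' closure U, edist (g x) (g y) ^ (-(s : ℝ)) ∂ν := by
            refine setLIntegral_mono' (hg hcl) fun y hy => ?_
            rw [ENNReal.rpow_neg, ENNReal.rpow_neg]
            gcongr
            exact Metric.edist_le_ediam_of_mem hxU hy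
        _ ≤ φ x := setLIntegral_le_lintegral _ _
        _ ≤ M := hxG
    refine (measure_mono inter_subset_left).trans ?_
    -- Diameter zero: `d ^ (-s) = ∞`, so a finite potential forces the mass to vanish.
    rcases eq_or_ne d 0 with h0 | h0
    · rw [h0, ENNReal.zero_rpow_of_neg (by simpa using hs)] at h1
      by_contra! hcon
      rw [ENNReal.top_mul (by rintro h; simp [h] at hcon)] at h1
      simp at h1
    rcases eq_or_ne d ∞ with ht | ht
    · rw [ht, ENNReal.top_rpow_of_pos (by simpa using hs)]
      rw [ENNReal.mul_top (by exact_mod_cast hMp.ne')]; exact le_top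
    · rw [ENNReal.rpow_neg] at h1
      have hd0 : d ^ (s : ℝ) ≠ 0 := by simp [h0, ht]
      have hdt : d ^ (s : ℝ) ≠ ∞ := by simp [h0, ht]
      rw [mul_comm, ← div_eq_mul_inv] at h1
      exact (ENNReal.div_le_iff hd0 hdt).1 h1
  have hM0 : (M : ℝ≥0∞) ≠ 0 := by exact_mod_cast hMp.ne'
  have hMt : (M : ℝ≥0∞) ≠ ∞ := ENNReal.natCast_ne_top M
  have hle : (M : ℝ≥0∞)⁻¹ • (ν.restrict G).map g ≤ μH[(s : ℝ)] := by
    refine Measure.le_hausdorffMeasure _ _ ∞ ENNReal.coe_lt_top fun U _ => ?_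
    rw [Measure.smul_apply, smul_eq_mul, ENNReal.inv_mul_le_iff hM0 hMt]
    exact hball U
  refine le_dimH_of_hausdorffMeasure_ne_zero fun h0 => hM ?_
  have h1 := hle (g '' B)
  rw [h0, Measure.smul_apply, smul_eq_mul, nonpos_iff_eq_zero, mul_eq_zero] at h1
  have h2 : (ν.restrict G) B = 0 := by
    rcases h1 with h1 | h1
    · simp at h1
    · refine measure_mono_null (subset_preimage_image g B) ?_
      exact le_antisymm ((Measure.le_map_apply hg.aemeasurable _).trans h1.le) zero_le
  have h3 : (ν.restrict G) Bᶜ = 0 := Measure.absolutelyContinuous_of_le Measure.restrict_le_self hB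
  have h4 := measure_union_null h2 h3
  rwa [union_compl_self, Measure.restrict_apply_univ] at h4

/-! ### Oscillation of a single layer -/

theorem abs_iInf_sub_iInf_le_sum {ι : Type*} [Fintype ι] [Nonempty ι] (f g : ι → ℝ) :
    |(⨅ i, f i) - ⨅ i, g i| ≤ ∑ i, |f i - g i| := by
  have key : ∀ f g : ι → ℝ, (⨅ i, f i) - ∑ i, |f i - g i| ≤ ⨅ i, g i := fun f g =>
    le_ciInf fun i => by
      have h1 : (⨅ i, f i) ≤ f i := ciInf_le (Set.finite_range f).bddBelow i
      have h2 : |f i - g i| ≤ ∑ i, |f i - g i| :=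
        Finset.single_le_sum (f := fun i => |f i - g i|) (fun i _ => abs_nonneg _)
          (Finset.mem_univ i)
      linarith [le_abs_self (f i - g i)]
  have h1 := key f g
  have h2 := key g f
  simp only [abs_sub_comm (g _)] at h2
  rw [abs_sub_le_iff]
  constructor <;> linarith

/-- The rising side of a tent over `[a, a + s]` with apex above `a + w`. -/
def rise (a w y : ℝ) : ℝ := min 1 ((y - a) / w)

/-- The falling side of a tent over `[a, a + s]` with apex above `a + w`. -/
def fall (a s w y : ℝ) : ℝ := min 1 ((a + s - y) / (s - w))

/-- A monotone function of the `i`-th coordinate whose increments control the oscillation of the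
layer in the direction `i`, in the column of cubes that passes through the cube of index `k`. -/
def columnControl {D : ℕ} (s : ℝ) (t : Space D) (v : (Fin D → ℤ) → Space D) (k : Fin D → ℤ)
    (i : Fin D) (y : ℝ) : ℝ :=
  3 * (⌊(y - t i) / s⌋ : ℝ)
    + rise (t i + s * ⌊(y - t i) / s⌋) (v (Function.update k i ⌊(y - t i) / s⌋) i) y
    + (1 - fall (t i + s * ⌊(y - t i) / s⌋) s (v (Function.update k i ⌊(y - t i) / s⌋) i) y)

section

variable {D : ℕ} {s : ℝ} {t : Space D} {v : (Fin D → ℤ) → Space D}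

theorem cell_bounds (hs : 0 < s) (t y : ℝ) :
    t + s * ⌊(y - t) / s⌋ ≤ y ∧ y < t + s * ⌊(y - t) / s⌋ + s := by
  have h1 := Int.floor_le ((y - t) / s)
  have h2 := Int.lt_floor_add_one ((y - t) / s)
  rw [le_div_iff₀ hs] at h1
  rw [div_lt_iff₀ hs] at h2
  constructor <;> nlinarith

/-- The two truncated sides contribute between 0 and 2. With coefficient 3 on the cell number,
entering a new cell therefore raises the control by at least 1, the largest possible oscillation of
the layer. -/
theorem columnControl_bounds (hs : 0 < s) (hv : ∀ k, v k ∈ openCube D s) (k : Fin D → ℤ)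
    (i : Fin D) (y : ℝ) :
    3 * (⌊(y - t i) / s⌋ : ℝ) ≤ columnControl s t v k i y ∧
      columnControl s t v k i y ≤ 3 * (⌊(y - t i) / s⌋ : ℝ) + 2 := by
  obtain ⟨h1, h2⟩ := cell_bounds hs (t i) y
  obtain ⟨h3, h4⟩ := hv (Function.update k i ⌊(y - t i) / s⌋) i
  unfold columnControl rise fall
  set m : ℝ := (⌊(y - t i) / s⌋ : ℝ)
  set w := v (Function.update k i ⌊(y - t i) / s⌋) i
  have h5 : 0 ≤ (y - (t i + s * m)) / w := div_nonneg (by linarith) h3.le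
  have h6 : 0 ≤ (t i + s * m + s - y) / (s - w) := div_nonneg (by linarith) (by linarith)
  have h7 := min_le_left 1 ((y - (t i + s * m)) / w)
  have h8 := min_le_left 1 ((t i + s * m + s - y) / (s - w))
  have h9 := le_min zero_le_one h5
  have h10 := le_min zero_le_one h6
  constructor <;> linarith

theorem columnControl_mono (hs : 0 < s) (hv : ∀ k, v k ∈ openCube D s) (k : Fin D → ℤ)
    (i : Fin D) : Monotone (columnControl s t v k i) := by
  intro y z hyz
  have hfl : ⌊(y - t i) / s⌋ ≤ ⌊(z - t i) / s⌋ := Int.floor_le_floor (by gcongr)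
  rcases hfl.eq_or_lt with heq | hlt
  · unfold columnControl rise fall
    rw [← heq]
    obtain ⟨h3, h4⟩ := hv (Function.update k i ⌊(y - t i) / s⌋) i
    have : 0 < s - v (Function.update k i ⌊(y - t i) / s⌋) i := by linarith
    gcongr
  · have h1 := (columnControl_bounds (t := t) hs hv k i y).2
    have h2 := (columnControl_bounds (t := t) hs hv k i z).1
    have h3 : (⌊(y - t i) / s⌋ : ℝ) + 1 ≤ ⌊(z - t i) / s⌋ := by exact_mod_cast hlt
    linarith

theorem layer_mem_Icc [NeZero D] (hs : 0 < s) (hv : ∀ k, v k ∈ openCube D s) (x : Space D) :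
    layer s t v x ∈ Icc (0 : ℝ) 1 := by
  unfold layer cubePyramid
  set k := cubeIndex s t x with hk
  have hb : ∀ i, 0 ≤ min ((x i - cubeCorner s t k i) / ((cubeCorner s t k + v k) i - cubeCorner s t k i))
      ((cubeCorner s t k i + s - x i) / (cubeCorner s t k i + s - (cubeCorner s t k + v k) i)) ∧
      min ((x i - cubeCorner s t k i) / ((cubeCorner s t k + v k) i - cubeCorner s t k i))
      ((cubeCorner s t k i + s - x i) / (cubeCorner s t k i + s - (cubeCorner s t k + v k) i)) ≤ 1 := by
    intro i
    obtain ⟨h1, h2⟩ := cell_bounds hs (t i) (x i)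
    have h3 := hv k i
    have hc : cubeCorner s t k i = t i + s * ⌊(x i - t i) / s⌋ := rfl
    rw [← hc] at h1 h2
    rw [PiLp.add_apply, add_sub_cancel_left, add_sub_add_left_eq_sub]
    generalize cubeCorner s t k i = a at *
    generalize v k i = w at *
    refine ⟨le_min (div_nonneg (by linarith) h3.1.le) (div_nonneg (by linarith) (by linarith)), ?_⟩
    rcases le_total (x i - a) w with h | h
    · exact (min_le_left _ _).trans ((div_le_one h3.1).2 h)
    · exact (min_le_right _ _).trans ((div_le_one (by linarith)).2 (by linarith))
  exact ⟨le_ciInf fun i => (hb i).1, (ciInf_le (Set.finite_range _).bddBelow 0).trans (hb 0).2⟩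

/-- If `p` and `q` share a cell, the layer is a minimum of rising and falling sides, and each side
changes by at most the increment of its control. Otherwise some coordinate enters a new cell, where
the control gains at least 1. -/
theorem abs_layer_sub_layer_le [NeZero D] (hs : 0 < s) (hv : ∀ k, v k ∈ openCube D s)
    {p q x : Space D} (hpx : ∀ i, p i ≤ x i) (hxq : ∀ i, x i ≤ q i) :
    |layer s t v x - layer s t v p| ≤ ∑ i, (columnControl s t v (cubeIndex s t p) i (q i)
      - columnControl s t v (cubeIndex s t p) i (p i)) := by
  set k := cubeIndex s t p with hk
  have hmono := fun i => columnControl_mono (t := t) hs hv k i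
  by_cases hall : ∀ i, ⌊(q i - t i) / s⌋ = ⌊(p i - t i) / s⌋
  · have hx : ∀ i, ⌊(x i - t i) / s⌋ = ⌊(p i - t i) / s⌋ := fun i =>
      le_antisymm ((Int.floor_le_floor (by gcongr; exact hxq i)).trans (hall i).le)
        (Int.floor_le_floor (by gcongr; exact hpx i))
    have hxk : cubeIndex s t x = k := funext hx
    unfold layer cubePyramid
    rw [hxk, ← hk]
    refine (abs_iInf_sub_iInf_le_sum _ _).trans (Finset.sum_le_sum fun i _ => ?_)
    refine le_trans ?_ (sub_le_sub_right (hmono i (hxq i)) _)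
    obtain ⟨h1, h2⟩ := cell_bounds hs (t i) (x i)
    obtain ⟨h1', h2'⟩ := cell_bounds hs (t i) (p i)
    have h3 := hv k i
    have hup : Function.update k i ⌊(p i - t i) / s⌋ = k := Function.update_eq_self i k
    unfold columnControl rise fall
    rw [hx] at h1 h2 ⊢
    rw [hup]
    have hc : cubeCorner s t k i = t i + s * ⌊(p i - t i) / s⌋ := rfl
    rw [← hc] at h1 h2 h1' h2' ⊢
    rw [PiLp.add_apply, add_sub_cancel_left, add_sub_add_left_eq_sub]
    have hpx := hpx i
    generalize cubeCorner s t k i = a at *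
    generalize v k i = w at *
    generalize x i = x at *
    generalize p i = p at *
    -- A tent is at most 1, so truncating both sides at 1 leaves it unchanged. Untruncated, a side
    -- can be large when the nucleus is near the boundary.
    have hmin : ∀ y, min ((y - a) / w) ((a + s - y) / (s - w))
        = min (min 1 ((y - a) / w)) (min 1 ((a + s - y) / (s - w))) := by
      intro y
      rw [min_min_min_comm, min_self, eq_comm, min_eq_right]
      rcases le_total (y - a) w with h | h
      · exact (min_le_left _ _).trans ((div_le_one h3.1).2 h)
      · exact (min_le_right _ _).trans ((div_le_one (by linarith)).2 (by linarith))
    have hw : 0 < s - w := by linarith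
    have hw' := h3.1
    have hr : min 1 ((p - a) / w) ≤ min 1 ((x - a) / w) := by gcongr
    have hf : min 1 ((a + s - x) / (s - w)) ≤ min 1 ((a + s - p) / (s - w)) := by gcongr
    rw [hmin x, hmin p]
    refine (abs_min_sub_min_le_max _ _ _ _).trans (max_le ?_ ?_)
    · rw [abs_of_nonneg (by linarith)]; linarith
    · rw [abs_of_nonpos (by linarith)]; linarith
  · push Not at hall
    obtain ⟨i, hi⟩ := hall
    have hlt : ⌊(p i - t i) / s⌋ < ⌊(q i - t i) / s⌋ :=
      lt_of_le_of_ne (Int.floor_le_floor (by gcongr; exact (hpx i).trans (hxq i))) hi.symm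
    have h3 : (⌊(p i - t i) / s⌋ : ℝ) + 1 ≤ ⌊(q i - t i) / s⌋ := by exact_mod_cast hlt
    have h1 := (columnControl_bounds (t := t) hs hv k i (p i)).2
    have h2 := (columnControl_bounds (t := t) hs hv k i (q i)).1
    have h4 := layer_mem_Icc (t := t) hs hv x
    have h5 := layer_mem_Icc (t := t) hs hv p
    have h6 : |layer s t v x - layer s t v p| ≤ 1 :=
      abs_sub_le_iff.2 ⟨by linarith [h4.2, h5.1], by linarith [h4.1, h5.2]⟩
    refine h6.trans (le_trans ?_ (Finset.single_le_sum (fun j _ => ?_) (Finset.mem_univ i)))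
    · linarith
    · exact sub_nonneg.2 (hmono j ((hpx j).trans (hxq j)))

end

/-! ### Summing oscillations over grid lines -/

/-- The map `(j, l) ↦ (update j i l, j i)` is an involution. It turns a sum over the grid into an
average of sums over lines in direction `i`. -/
theorem sum_sum_update {ι κ : Type*} [Fintype ι] [DecidableEq ι] [Fintype κ] (f : (ι → κ) → ℝ) (i : ι) :
    ∑ j, ∑ l, f (Function.update j i l) = Fintype.card κ * ∑ j, f j := by
  rw [← Fintype.sum_prod_type']
  let e : (ι → κ) × κ ≃ (ι → κ) × κ :=
    { toFun := fun p => (Function.update p.1 i p.2, p.1 i)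
      invFun := fun p => (Function.update p.1 i p.2, p.1 i)
      left_inv := fun p => by simp
      right_inv := fun p => by simp }
  rw [Fintype.sum_equiv e (fun p => f (Function.update p.1 i p.2)) (fun p => f p.1) (fun _ => rfl),
    Fintype.sum_prod_type]
  simp [Finset.mul_sum]

/-- The lower corner of the cube of index `j` of the mesh of side `1 / N`. -/
def gridPoint {D : ℕ} (N : ℕ) (j : Fin D → ℕ) : Space D := WithLp.toLp 2 fun i => (j i : ℝ) / N

/-- A bound for the oscillation of the layer on the cube of index `j` of the mesh of side `1/N`. -/
def gridControl {D : ℕ} (s : ℝ) (t : Space D) (v : (Fin D → ℤ) → Space D) (N : ℕ)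
    (j : Fin D → Fin (N + 1)) : ℝ :=
  ∑ i, (columnControl s t v (cubeIndex s t (gridPoint N fun i => j i)) i (((j i : ℕ) + 1 : ℕ) / N)
    - columnControl s t v (cubeIndex s t (gridPoint N fun i => j i)) i ((j i : ℕ) / N))

/-- Along a line in direction `i` all controls are one function, because `Function.update` erases
the only coordinate of the cell index that varies. The increments telescope, whatever the nuclei. -/
theorem sum_gridControl_le {D : ℕ} {s : ℝ} {t : Space D} {v : (Fin D → ℤ) → Space D}
    (hs : 0 < s) (hs1 : s ≤ 1) (hv : ∀ k, v k ∈ openCube D s) {N : ℕ} (hN : 1 ≤ N) :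
    ∑ j : Fin D → Fin (N + 1), gridControl s t v N j
      ≤ ((N : ℝ) + 1) ^ D * (11 * D / (N * s)) := by
  unfold gridControl
  rw [Finset.sum_comm]
  have hN0 : (0 : ℝ) < N := by exact_mod_cast hN
  have hcol : ∀ i : Fin D, ∑ j : Fin D → Fin (N + 1),
      (columnControl s t v (cubeIndex s t (gridPoint N fun i => j i)) i (((j i : ℕ) + 1 : ℕ) / N)
        - columnControl s t v (cubeIndex s t (gridPoint N fun i => j i)) i ((j i : ℕ) / N))
      ≤ ((N : ℝ) + 1) ^ D * (11 / (N * s)) := by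
    intro i
    set f : (Fin D → Fin (N + 1)) → ℝ := fun j =>
      (columnControl s t v (cubeIndex s t (gridPoint N fun i => j i)) i (((j i : ℕ) + 1 : ℕ) / N)
        - columnControl s t v (cubeIndex s t (gridPoint N fun i => j i)) i ((j i : ℕ) / N)) with hf
    have hline : ∀ j, ∑ l, f (Function.update j i l) ≤ 11 / s := by
      intro j
      set k := cubeIndex s t (gridPoint N fun i => j i) with hk
      have hfl : ∀ l : Fin (N + 1), f (Function.update j i l)
          = columnControl s t v k i (((l : ℕ) + 1 : ℕ) / N) - columnControl s t v k i ((l : ℕ) / N) := by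
        intro l
        have hcc : ∀ y, columnControl s t v
            (cubeIndex s t (gridPoint N fun i' => (Function.update j i l i' : ℕ))) i y
            = columnControl s t v k i y := by
          intro y
          have hu : ∀ m : ℤ, Function.update
              (cubeIndex s t (gridPoint N fun i' => (Function.update j i l i' : ℕ))) i m
              = Function.update k i m := by
            intro m
            funext i'
            rcases eq_or_ne i' i with rfl | hne
            · simp
            · simp [hne, hk, cubeIndex, gridPoint]
          unfold columnControl
          rw [hu]
        simp only [hf, hcc, Function.update_self]
      simp only [hfl]
      rw [Fin.sum_univ_eq_sum_range (fun l : ℕ => columnControl s t v k i (((l : ℕ) + 1 : ℕ) / N)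
        - columnControl s t v k i ((l : ℕ) / N)) (N + 1),
        Finset.sum_range_sub (fun l : ℕ => columnControl s t v k i ((l : ℕ) / N))]
      have h1 := (columnControl_bounds (t := t) hs hv k i (((N + 1 : ℕ) : ℝ) / N)).2
      have h2 := (columnControl_bounds (t := t) hs hv k i (((0 : ℕ) : ℝ) / N)).1
      have h3 := Int.floor_le ((((N + 1 : ℕ) : ℝ) / N - t i) / s)
      have h4 := Int.lt_floor_add_one ((((0 : ℕ) : ℝ) / N - t i) / s)
      have h5 : (((N + 1 : ℕ) : ℝ) / N - t i) / s - (((0 : ℕ) : ℝ) / N - t i) / s ≤ 2 / s := by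
        rw [← sub_div]
        gcongr
        have : ((N + 1 : ℕ) : ℝ) / N ≤ 2 := by
          rw [div_le_iff₀ hN0]; push_cast; have : (1 : ℝ) ≤ N := by exact_mod_cast hN
          linarith
        simp only [Nat.cast_zero, zero_div]
        linarith
      -- The two floors differ by at most `2/s + 1`, so the line sum is at most `3 * (2/s + 1) + 2 ≤
      -- 11/s` because `s ≤ 1`.
      have h6 : 1 ≤ 1 / s := by rw [le_div_iff₀ hs]; linarith
      have h7 : 2 / s = 2 * (1 / s) := by ring
      have h8 : 11 / s = 11 * (1 / s) := by ring
      linarith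
    have hsum := sum_sum_update f i
    have hle : ∑ j, ∑ l, f (Function.update j i l) ≤ ((N : ℝ) + 1) ^ D * (11 / s) := by
      refine (Finset.sum_le_sum fun j _ => hline j).trans ?_
      simp
    rw [hsum, Fintype.card_fin] at hle
    push_cast at hle
    have hfs : ∑ j, f j ≤ ((N : ℝ) + 1) ^ D * (11 / s) / (N + 1) := by
      rw [le_div_iff₀ (by positivity)]; linarith
    refine hfs.trans ?_
    rw [mul_div_assoc, div_div, mul_comm s]
    gcongr
    linarith
  refine (Finset.sum_le_sum fun i _ => hcol i).trans ?_
  simp only [Finset.sum_const, Finset.card_univ, Fintype.card_fin, nsmul_eq_mul]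
  apply le_of_eq
  ring

/-! ### Oscillation of the series and the upper box bound -/

theorem rpow_neg_natCast_mul_div (lam : ℝ) (hlam : 1 < lam) (a : ℝ) (D n : ℕ) :
    lam ^ (-(n * a / D)) = (lam ^ (-(a / D))) ^ n := by
  rw [← Real.rpow_mul_natCast (by linarith)]
  ring_nf

theorem meshSide_pos {lam : ℝ} (hlam : 1 < lam) (D : ℕ) (β : ℝ) (n : ℕ) :
    0 < meshSide D lam β n := Real.rpow_pos_of_pos (by linarith) _

theorem meshSide_le_one {lam β : ℝ} (hlam : 1 < lam) (hβ : 0 ≤ β) (D n : ℕ) :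
    meshSide D lam β n ≤ 1 :=
  Real.rpow_le_one_of_one_le_of_nonpos hlam.le (by
    have : 0 ≤ n * β / D := by positivity
    linarith)

theorem summable_rpow_neg_natCast_mul_div {lam a : ℝ} (hlam : 1 < lam) (ha : 0 < a) (D : ℕ)
    [NeZero D] : Summable fun n : ℕ => lam ^ (-(n * a / D)) := by
  have hD : (0 : ℝ) < D := by exact_mod_cast Nat.pos_of_ne_zero (NeZero.ne D)
  simp only [rpow_neg_natCast_mul_div lam hlam]
  refine summable_geometric_of_lt_one (by positivity) ?_
  exact Real.rpow_lt_one_of_one_lt_of_neg hlam (by rw [neg_lt_zero]; positivity)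

theorem gridControl_nonneg {D : ℕ} {s : ℝ} {t : Space D} {v : (Fin D → ℤ) → Space D}
    (hs : 0 < s) (hv : ∀ k, v k ∈ openCube D s) (N : ℕ) (j : Fin D → Fin (N + 1)) :
    0 ≤ gridControl s t v N j :=
  Finset.sum_nonneg fun i _ => sub_nonneg.2 (columnControl_mono hs hv _ i (by gcongr; simp))

section

variable {D : ℕ} [NeZero D] {lam α β : ℝ} {t : ℕ → Space D} {v : ℕ → (Fin D → ℤ) → Space D}

theorem summable_mul_of_mem_Icc (hlam : 1 < lam) (hα : 0 < α) {f : ℕ → ℝ}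
    (hf : ∀ n, f n ∈ Icc (0 : ℝ) 1) : Summable fun n : ℕ => lam ^ (-(n * α / D)) * f n := by
  refine (summable_rpow_neg_natCast_mul_div hlam hα D).of_nonneg_of_le (fun n => ?_) (fun n => ?_)
  · exact mul_nonneg (Real.rpow_nonneg (by linarith) _) (hf n).1
  · exact mul_le_of_le_one_right (Real.rpow_nonneg (by linarith) _) (hf n).2

/-- A bound for the oscillation of the series on the cube of index `j` of the mesh of side `1/N`. -/
def seriesControl (lam α β : ℝ) (t : ℕ → Space D) (v : ℕ → (Fin D → ℤ) → Space D) (N : ℕ)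
    (j : Fin D → Fin (N + 1)) : ℝ :=
  ∑' n : ℕ, lam ^ (-(n * α / D)) * min 1 (gridControl (meshSide D lam β n) (t n) (v n) N j)

theorem abs_series_sub_series_le (hlam : 1 < lam) (hα : 0 < α)
    (hv : ∀ n k, v n k ∈ openCube D (meshSide D lam β n)) {N : ℕ} {j : Fin D → Fin (N + 1)}
    {x : Space D} (hx1 : ∀ i, ((j i : ℕ) : ℝ) / N ≤ x i)
    (hx2 : ∀ i, x i ≤ (((j i : ℕ) + 1 : ℕ) : ℝ) / N) :
    |series lam α β t v x - series lam α β t v (gridPoint N fun i => j i)|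
      ≤ seriesControl lam α β t v N j := by
  have hl := fun y n => layer_mem_Icc (t := t n) (meshSide_pos hlam D β n) (hv n) y
  unfold series seriesControl
  rw [← (summable_mul_of_mem_Icc hlam hα (hl _)).tsum_sub (summable_mul_of_mem_Icc hlam hα (hl _)),
    ← Real.norm_eq_abs]
  refine tsum_of_norm_bounded (Summable.hasSum ?_) fun n => ?_
  · exact summable_mul_of_mem_Icc hlam hα fun n =>
      ⟨le_min zero_le_one (gridControl_nonneg (meshSide_pos hlam D β n) (hv n) N j), min_le_left _ _⟩
  · rw [← mul_sub, norm_mul, Real.norm_of_nonneg (Real.rpow_nonneg (by linarith) _),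
      Real.norm_eq_abs]
    gcongr
    refine le_min ?_ ?_
    · have h1 := hl x n
      have h2 := hl (gridPoint N fun i => j i) n
      exact abs_sub_le_iff.2 ⟨by linarith [h1.2, h2.1], by linarith [h1.1, h2.2]⟩
    · exact abs_layer_sub_layer_le (q := WithLp.toLp 2 fun i => (((j i : ℕ) + 1 : ℕ) : ℝ) / N)
        (meshSide_pos hlam D β n) (hv n) hx1 hx2

/-- The trivial bound 1 and the variation bound are interpolated by `min 1 X ≤ X^θ`. The sum over
generations is then geometric with ratio `lam ^ (-(α - θβ)/D)`, less than 1 because `θβ < α`. -/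
theorem sum_seriesControl_le (hlam : 1 < lam) (hα : 0 < α) (hβ : 0 < β)
    (hv : ∀ n k, v n k ∈ openCube D (meshSide D lam β n)) {θ : ℝ} (hθ0 : 0 < θ) (hθ1 : θ ≤ 1)
    (hθ : θ * β < α) : ∃ C : ℝ, 0 ≤ C ∧ ∀ N : ℕ, 1 ≤ N →
      ∑ j, seriesControl lam α β t v N j ≤ C * (N : ℝ) ^ ((D : ℝ) - θ) := by
  have hlam0 : 0 < lam := by linarith
  have hD : (0 : ℝ) < D := by exact_mod_cast Nat.pos_of_ne_zero (NeZero.ne D)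
  have hsum := summable_rpow_neg_natCast_mul_div (a := α - θ * β) hlam (by linarith) D
  refine ⟨2 ^ D * (11 * D) ^ θ * ∑' n : ℕ, lam ^ (-(n * (α - θ * β) / D)),
    mul_nonneg (by positivity) (tsum_nonneg fun n => by positivity), fun N hN => ?_⟩
  have hN0 : (0 : ℝ) < N := by exact_mod_cast hN
  have hN1 : (1 : ℝ) ≤ N := by exact_mod_cast hN
  unfold seriesControl
  have hmem : ∀ (j : Fin D → Fin (N + 1)) (n : ℕ),
      min 1 (gridControl (meshSide D lam β n) (t n) (v n) N j) ∈ Icc (0 : ℝ) 1 := fun j n =>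
    ⟨le_min zero_le_one (gridControl_nonneg (meshSide_pos hlam D β n) (hv n) N j), min_le_left _ _⟩
  rw [← Summable.tsum_finsetSum fun j _ => summable_mul_of_mem_Icc hlam hα (hmem j)]
  have hterm : ∀ n : ℕ, ∑ j, lam ^ (-(n * α / D)) *
      min 1 (gridControl (meshSide D lam β n) (t n) (v n) N j)
      ≤ (2 ^ D * (11 * D) ^ θ * (N : ℝ) ^ ((D : ℝ) - θ)) * lam ^ (-(n * (α - θ * β) / D)) := by
    intro n
    have hs := meshSide_pos hlam D β n
    rw [← Finset.mul_sum]
    set X := 11 * (D : ℝ) / (N * meshSide D lam β n) with hX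
    have hX0 : 0 < X := by positivity
    have h1 : ∑ j, min 1 (gridControl (meshSide D lam β n) (t n) (v n) N j)
        ≤ ((N : ℝ) + 1) ^ D * min 1 X := by
      rw [mul_min_of_nonneg _ _ (by positivity)]
      refine le_min ?_ ?_
      · refine (Finset.sum_le_sum fun j _ => (hmem j n).2).trans ?_
        simp
      · refine (Finset.sum_le_sum fun j _ => min_le_right _ _).trans ?_
        exact sum_gridControl_le hs (meshSide_le_one hlam hβ.le D n) (hv n) hN
    have h2 : min 1 X ≤ X ^ θ := by
      rcases le_total X 1 with h | h
      · rw [min_eq_right h]; exact Real.self_le_rpow_of_le_one hX0.le h hθ1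
      · rw [min_eq_left h]; exact Real.one_le_rpow h hθ0.le
    have h3 : ((N : ℝ) + 1) ^ D ≤ (2 * N) ^ D := by gcongr; linarith
    calc lam ^ (-(n * α / D)) * ∑ j, min 1 (gridControl (meshSide D lam β n) (t n) (v n) N j)
        ≤ lam ^ (-(n * α / D)) * ((2 * N) ^ D * X ^ θ) := by
          gcongr
          exact h1.trans (mul_le_mul h3 h2 (le_min zero_le_one hX0.le) (by positivity))
      _ = _ := by
          have h4 : lam ^ (-(n * (α - θ * β) / D))
              = lam ^ (-(n * α / D)) * (meshSide D lam β n ^ θ)⁻¹ := by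
            unfold meshSide
            rw [← Real.rpow_mul hlam0.le, ← Real.rpow_neg hlam0.le, ← Real.rpow_add hlam0]
            congr 1
            ring
          rw [h4, hX, Real.div_rpow (by positivity) (by positivity),
            Real.mul_rpow hN0.le hs.le, Real.rpow_sub hN0, Real.rpow_natCast, mul_pow]
          field_simp
  calc _ ≤ ∑' n : ℕ, (2 ^ D * (11 * D) ^ θ * (N : ℝ) ^ ((D : ℝ) - θ))
        * lam ^ (-(n * (α - θ * β) / D)) :=
        Summable.tsum_le_tsum hterm
          (summable_sum fun j _ => summable_mul_of_mem_Icc hlam hα (hmem j)) (hsum.mul_left _)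
    _ = _ := by rw [tsum_mul_left]; ring

/-- A point of the graph is labelled by its grid cube and by its height above the corner value in
units of `1/N`. Cube `j` needs at most `2⌈N b_j⌉ + 1 ≤ 2 N b_j + 3` labels, and points with equal
labels are within `√(D+1)/N`. -/
theorem coveringNumber_graphOnCube_le (hlam : 1 < lam) (hα : 0 < α)
    (hv : ∀ n k, v n k ∈ openCube D (meshSide D lam β n)) {N : ℕ} (hN : 1 ≤ N) :
    (Metric.coveringNumber (((D + 1 : ℕ) : ℝ≥0) / N) (graphOnCube (series lam α β t v)) : ℝ≥0∞)
      ≤ ENNReal.ofReal (3 * ((N : ℝ) + 1) ^ D + 2 * N * ∑ j, seriesControl lam α β t v N j) := by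
  have hN0 : (0 : ℝ) < N := by exact_mod_cast hN
  set F := series lam α β t v with hF
  set b := seriesControl lam α β t v N with hb
  -- Index `N` occurs when `x i = 1`; the reduction modulo `N + 1` is therefore harmless on the unit
  -- cube.
  let J : Space D → Fin D → Fin (N + 1) := fun x i => Fin.ofNat (N + 1) ⌊N * x i⌋₊
  let φ : WithLp 2 (Space D × ℝ) → Σ _ : Fin D → Fin (N + 1), ℤ := fun z =>
    ⟨J z.fst, ⌊N * (z.snd - F (gridPoint N fun i => J z.fst i))⌋⟩
  let S : Finset (Σ _ : Fin D → Fin (N + 1), ℤ) :=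
    Finset.univ.sigma fun j => Finset.Icc (-⌈N * b j⌉) ⌈N * b j⌉
  have hJ : ∀ x ∈ unitCube D, ∀ i, ((J x i : ℕ) : ℝ) / N ≤ x i ∧
      x i ≤ (((J x i : ℕ) + 1 : ℕ) : ℝ) / N := by
    intro x hx i
    have hval : (J x i : ℕ) = ⌊N * x i⌋₊ := by
      refine Nat.mod_eq_of_lt (Nat.lt_succ_of_le (Nat.floor_le_of_le ?_))
      exact mul_le_of_le_one_right hN0.le (hx i).2
    rw [hval]
    have h1 := Nat.floor_le (mul_nonneg hN0.le (hx i).1)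
    have h2 := Nat.lt_floor_add_one (N * x i)
    push_cast
    rw [div_le_iff₀ hN0, le_div_iff₀ hN0]
    constructor <;> linarith
  have hb0 : ∀ j, 0 ≤ b j := fun j => tsum_nonneg fun n =>
    mul_nonneg (Real.rpow_nonneg (by linarith) _)
      (le_min zero_le_one (gridControl_nonneg (meshSide_pos hlam D β n) (hv n) N j))
  have hcard : (S.card : ℝ) ≤ 3 * ((N : ℝ) + 1) ^ D + 2 * N * ∑ j, b j := by
    have : S.card = ∑ j, (⌈N * b j⌉ + 1 - -⌈N * b j⌉).toNat := by
      simp [S, Finset.card_sigma]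
    rw [this, Nat.cast_sum]
    calc ∑ j, (((⌈N * b j⌉ + 1 - -⌈N * b j⌉).toNat : ℕ) : ℝ) ≤ ∑ j, (3 + 2 * N * b j) := by
          refine Finset.sum_le_sum fun j _ => ?_
          have h1 : 0 ≤ ⌈N * b j⌉ := Int.ceil_nonneg (mul_nonneg hN0.le (hb0 j))
          have h2 := Int.ceil_lt_add_one (N * b j)
          have h3 : (((⌈N * b j⌉ + 1 - -⌈N * b j⌉).toNat : ℕ) : ℝ)
              = ((⌈N * b j⌉ + 1 - -⌈N * b j⌉ : ℤ) : ℝ) := by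
            rw [← Int.cast_natCast, Int.toNat_of_nonneg (by omega)]
          rw [h3]
          push_cast
          linarith
      _ = _ := by
          rw [Finset.sum_add_distrib, Finset.mul_sum]
          simp [mul_comm]
  have hcov : Metric.coveringNumber (((D + 1 : ℕ) : ℝ≥0) / N) (graphOnCube F) ≤ S.card := by
    refine coveringNumber_le_card φ S ?_ ?_
    · rintro _ ⟨x, hx, rfl⟩
      have hosc := abs_series_sub_series_le (t := t) hlam hα hv (fun i => (hJ x hx i).1)
        (fun i => (hJ x hx i).2)
      rw [← hF, ← hb, abs_le] at hosc
      simp only [S, φ, Finset.mem_sigma, Finset.mem_univ, true_and, Finset.mem_Icc, Int.le_floor]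
      constructor
      · push_cast
        change -(⌈N * b (J x)⌉ : ℝ) ≤ N * (F x - F (gridPoint N fun i => J x i))
        have := Int.le_ceil (N * b (J x))
        nlinarith [hosc.1]
      · refine (Int.floor_le_floor ?_).trans (Int.floor_le_ceil _)
        gcongr
        exact hosc.2
    · rintro _ ⟨x, hx, rfl⟩ _ ⟨y, hy, rfl⟩ hxy
      have hJxy : J x = J y := congrArg Sigma.fst hxy
      have hfl : ⌊N * (F x - F (gridPoint N fun i => J x i))⌋
          = ⌊N * (F y - F (gridPoint N fun i => J x i))⌋ := by
        have := eq_of_heq (Sigma.mk.inj hxy).2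
        change _ = ⌊N * (F y - F (gridPoint N fun i => J y i))⌋ at this
        rwa [← hJxy] at this
      have hv' : |F x - F y| ≤ 1 / N := by
        have h1 := Int.abs_sub_lt_one_of_floor_eq_floor hfl
        rw [← mul_sub, sub_sub_sub_cancel_right, abs_mul, abs_of_pos hN0] at h1
        rw [le_div_iff₀ hN0, mul_comm]
        exact h1.le
      have hh : ∀ i, |x i - y i| ≤ 1 / N := by
        intro i
        have h1 := hJ x hx i
        have h2 := hJ y hy i
        rw [← hJxy] at h2
        push_cast at h1 h2
        rw [add_div] at h1 h2
        exact abs_sub_le_iff.2 ⟨by linarith, by linarith⟩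
      rw [edist_dist, ENNReal.ofReal_le_iff_le_toReal (by simp)]
      rw [ENNReal.coe_toReal, WithLp.prod_dist_eq_of_L2, EuclideanSpace.dist_eq]
      push_cast
      refine Real.sqrt_le_iff.2 ⟨by positivity, ?_⟩
      rw [Real.sq_sqrt (Finset.sum_nonneg fun i _ => sq_nonneg _)]
      have h1 : ∑ i, dist (x i) (y i) ^ 2 ≤ D * (1 / N) ^ 2 := by
        refine (Finset.sum_le_sum (g := fun _ => (1 / (N : ℝ)) ^ 2) fun i _ => ?_).trans (by simp)
        rw [Real.dist_eq]
        gcongr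
        exact hh i
      have h2 : dist (F x) (F y) ^ 2 ≤ (1 / N) ^ 2 := by
        rw [Real.dist_eq]; gcongr
      refine (add_le_add h1 h2).trans ?_
      rw [div_pow, div_pow]
      rw [mul_div_assoc', ← add_div]
      gcongr
      have : (0 : ℝ) ≤ D := by positivity
      nlinarith
  calc _ ≤ ((S.card : ℕ∞) : ℝ≥0∞) := by exact_mod_cast hcov
    _ = ENNReal.ofReal (S.card : ℝ) := by simp
    _ ≤ _ := ENNReal.ofReal_le_ofReal hcard

theorem upperBoxDim_graphOnCube_series_le (hlam : 1 < lam) (hα : 0 < α) (hαβ : α ≤ β)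
    (hv : ∀ n k, v n k ∈ openCube D (meshSide D lam β n)) :
    upperBoxDim (graphOnCube (series lam α β t v)) ≤ (((D : ℝ) + 1 - α / β : ℝ) : EReal) := by
  have hβ : 0 < β := by linarith
  refine EReal.le_of_forall_lt_iff_le.1 fun d hd => ?_
  have hd : (D : ℝ) + 1 - α / β < d := by exact_mod_cast hd
  obtain ⟨θ, hθ1, hθ2⟩ : ∃ θ, max 0 ((D : ℝ) + 1 - d) < θ ∧ θ < α / β :=
    exists_between (max_lt (by positivity) (by linarith))
  have hθ0 : 0 < θ := (le_max_left _ _).trans_lt hθ1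
  have hθd : (D : ℝ) + 1 - d < θ := (le_max_right _ _).trans_lt hθ1
  have hθ : θ * β < α := (lt_div_iff₀ hβ).1 hθ2
  have hθone : θ ≤ 1 := hθ2.le.trans ((div_le_one hβ).2 hαβ)
  obtain ⟨C, hC, hCN⟩ := sum_seriesControl_le (t := t) hlam hα hβ hv hθ0 hθone hθ
  have hD : (0 : ℝ) ≤ D := by positivity
  refine (upperBoxDim_le_of_coveringNumber_le (K := ((D + 1 : ℕ) : ℝ≥0))
    (C := 3 * 2 ^ D + 2 * C) (p := D + 1 - θ) (by positivity) (by positivity) (by linarith)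
    fun N hN => ?_).trans (by exact_mod_cast (by linarith : (D : ℝ) + 1 - θ ≤ d))
  refine (coveringNumber_graphOnCube_le hlam hα hv hN).trans (ENNReal.ofReal_le_ofReal ?_)
  have hN0 : (0 : ℝ) < N := by exact_mod_cast hN
  have hN1 : (1 : ℝ) ≤ N := by exact_mod_cast hN
  have h1 : ((N : ℝ) + 1) ^ D ≤ 2 ^ D * (N : ℝ) ^ ((D : ℝ) + 1 - θ) := by
    calc ((N : ℝ) + 1) ^ D ≤ (2 * N) ^ D := by gcongr; linarith
      _ = 2 ^ D * (N : ℝ) ^ (D : ℝ) := by rw [mul_pow, Real.rpow_natCast]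
      _ ≤ _ := by gcongr 2 ^ D * ?_; exact Real.rpow_le_rpow_of_exponent_le hN1 (by linarith)
  have h2 : (N : ℝ) ^ ((D : ℝ) + 1 - θ) = N * (N : ℝ) ^ ((D : ℝ) - θ) := by
    rw [add_sub_right_comm, Real.rpow_add hN0, Real.rpow_one, mul_comm]
  have h3 := mul_le_mul_of_nonneg_left (hCN N hN) hN0.le
  rw [add_mul]
  refine add_le_add (by linarith) ?_
  rw [h2]
  linarith

end

/-! ### Riesz potentials of a random tent -/

theorem enorm_rpow_neg_le_of_le {x y : ℝ} {θ : ℝ} (hθ : 0 ≤ θ) (h : |x| ≤ |y|) :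
    ‖y‖ₑ ^ (-θ) ≤ ‖x‖ₑ ^ (-θ) := by
  rw [ENNReal.rpow_neg, ENNReal.rpow_neg]
  gcongr
  exact enorm_le_iff_norm_le.2 h

theorem enorm_mul_rpow (x y θ : ℝ) : ‖x * y‖ₑ ^ θ = ‖x‖ₑ ^ θ * ‖y‖ₑ ^ θ := by
  rw [enorm_mul, ENNReal.mul_rpow_of_ne_top (by simp) (by simp)]

/-- The singularity is integrable on the line for `θ < 1`; at distance more than 1 from `c` the
integrand is at most 1. -/
theorem exists_lintegral_enorm_sub_rpow_le {θ : ℝ} (h0 : 0 < θ) (h1 : θ < 1) :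
    ∃ C : ℝ≥0∞, C ≠ ∞ ∧ ∀ c : ℝ, ∫⁻ v in Ioo (0 : ℝ) 1, ‖v - c‖ₑ ^ (-θ) ≤ C := by
  refine ⟨(∫⁻ v in Icc (-1 : ℝ) 1, ‖v‖ₑ ^ (-θ)) + 1, ?_, fun c => ?_⟩
  · refine ENNReal.add_ne_top.2 ⟨?_, by simp⟩
    have hloc : LocallyIntegrable (fun v : ℝ => ‖v‖ ^ (-θ)) volume := by
      refine locallyIntegrable_of_norm_le_rpow (C := 1) (α := θ) (by simp) ?_ ?_ ?_
      · simpa using h1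
      · exact Eventually.of_forall fun v => by
          rw [Real.norm_of_nonneg (by positivity), one_mul]
      · exact (by fun_prop : Measurable (fun v : ℝ => ‖v‖ ^ (-θ))).aestronglyMeasurable
    have hint := (hloc.integrableOn_isCompact (isCompact_Icc (a := (-1 : ℝ)) (b := 1))).2
    refine (lt_of_eq_of_lt (lintegral_congr_ae ?_) hint).ne
    have : ∀ᵐ v : ℝ ∂(volume.restrict (Icc (-1) 1)), v ≠ 0 := by
      refine ae_restrict_of_ae ?_
      simp [ae_iff]
    filter_upwards [this] with v hv
    rw [Real.enorm_of_nonneg (r := ‖v‖ ^ (-θ)) (by positivity),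
      ← ENNReal.ofReal_rpow_of_pos (norm_pos_iff.2 hv), ofReal_norm]
  · have hpt : ∀ v : ℝ, (Ioo (0 : ℝ) 1).indicator (fun v => ‖v - c‖ₑ ^ (-θ)) v
        ≤ (Icc (-1 : ℝ) 1).indicator (fun v => ‖v‖ₑ ^ (-θ)) (v - c)
          + (Ioo (0 : ℝ) 1).indicator (fun _ => 1) v := by
      intro v
      by_cases hv : v ∈ Ioo (0 : ℝ) 1
      · rw [indicator_of_mem hv, indicator_of_mem hv]
        by_cases hc : v - c ∈ Icc (-1 : ℝ) 1
        · rw [indicator_of_mem hc]; exact le_self_add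
        · rw [indicator_of_notMem hc, zero_add]
          refine (enorm_rpow_neg_le_of_le (x := 1) h0.le ?_).trans (by simp)
          rw [abs_one]
          by_contra! h
          exact hc (abs_le.1 h.le)
      · rw [indicator_of_notMem hv]; exact zero_le
    rw [← lintegral_indicator measurableSet_Ioo, ← lintegral_indicator measurableSet_Icc]
    refine (lintegral_mono hpt).trans ?_
    rw [lintegral_add_right _ (measurable_const.indicator measurableSet_Ioo),
      lintegral_sub_right_eq_self (μ := volume)
        (fun v => (Icc (-1 : ℝ) 1).indicator (fun v => ‖v‖ₑ ^ (-θ)) v) c,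
      lintegral_indicator measurableSet_Ioo]
    simp

theorem enorm_half_rpow_le {θ : ℝ} (h1 : θ ≤ 1) (u : ℝ) :
    ‖u / 2‖ₑ ^ (-θ) ≤ 2 * ‖u‖ₑ ^ (-θ) := by
  rw [div_eq_mul_inv, mul_comm, enorm_mul_rpow]
  gcongr
  rw [enorm_inv two_ne_zero, ENNReal.inv_rpow, ENNReal.rpow_neg, inv_inv]
  calc ‖(2 : ℝ)‖ₑ ^ θ ≤ ‖(2 : ℝ)‖ₑ ^ (1 : ℝ) := by
        refine ENNReal.rpow_le_rpow_of_exponent_le ?_ h1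
        rw [Real.enorm_of_nonneg (by norm_num)]; norm_num
    _ = 2 := by rw [ENNReal.rpow_one, Real.enorm_of_nonneg (by norm_num)]; norm_num

/-- If `|r| ≤ u/2`, then `u/v + r ≥ u/2`. Otherwise `u/v + r = (r/v)(v + u/r)` with `|r/v| ≥ u/2`,
which leaves a singularity linear in `v`. -/
theorem exists_enorm_div_add_rpow_le {θ u : ℝ} (h0 : 0 < θ) (h1 : θ < 1) (hu : 0 < u) (r : ℝ) :
    ∃ c : ℝ, ∀ v ∈ Ioo (0 : ℝ) 1,
      ‖u / v + r‖ₑ ^ (-θ) ≤ 2 * ‖u‖ₑ ^ (-θ) * (1 + ‖v - c‖ₑ ^ (-θ)) := by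
  refine ⟨-(u / r), fun v hv => ?_⟩
  have hdiv : u ≤ u / v := (le_div_iff₀ hv.1).2 (by nlinarith [hv.2])
  rcases le_or_gt |r| (u / 2) with hr | hr
  · calc ‖u / v + r‖ₑ ^ (-θ) ≤ ‖u / 2‖ₑ ^ (-θ) := by
          refine enorm_rpow_neg_le_of_le h0.le ?_
          rw [abs_of_pos (by linarith : (0 : ℝ) < u / 2)]
          exact le_trans (by linarith [(abs_le.1 hr).1]) (le_abs_self _)
      _ ≤ 2 * ‖u‖ₑ ^ (-θ) * 1 := by rw [mul_one]; exact enorm_half_rpow_le h1.le u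
      _ ≤ _ := by gcongr; exact le_self_add
  · have hr0 : r ≠ 0 := by rintro rfl; simp at hr; linarith
    have heq : u / v + r = r / v * (v - -(u / r)) := by
      have := hv.1.ne'
      field_simp
      ring
    rw [heq, enorm_mul_rpow]
    refine mul_le_mul' ?_ le_add_self
    refine (enorm_rpow_neg_le_of_le h0.le ?_).trans (enorm_half_rpow_le h1.le u)
    rw [abs_of_pos (by linarith : (0 : ℝ) < u / 2), abs_div, abs_of_pos hv.1, le_div_iff₀ hv.1]
    nlinarith [hv.2, hv.1]

/-- For a uniform apex the height of a tent at the point `u` has bounded Riesz potentials. -/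
theorem exists_lintegral_enorm_tent_le {θ : ℝ} (h0 : 0 < θ) (h1 : θ < 1) :
    ∃ C : ℝ≥0∞, C ≠ ∞ ∧ ∀ u ∈ Ico (0 : ℝ) 1, ∀ w > 0, ∀ r : ℝ,
      ∫⁻ v in Ioo (0 : ℝ) 1, ‖w * min (u / v) ((1 - u) / (1 - v)) + r‖ₑ ^ (-θ)
        ≤ C * ‖w‖ₑ ^ (-θ) * (‖u‖ₑ ^ (-θ) + ‖1 - u‖ₑ ^ (-θ)) := by
  obtain ⟨C, hC, hCle⟩ := exists_lintegral_enorm_sub_rpow_le h0 h1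
  refine ⟨2 * (1 + C), ENNReal.mul_ne_top (by simp) (by simp [hC]), fun u hu w hw r => ?_⟩
  have hw0 : ‖w‖ₑ ^ (-θ) ≠ 0 := by simp [ENNReal.rpow_eq_zero_iff, hw.ne', h0.not_gt]
  rcases hu.1.eq_or_lt with rfl | hu0
  · rw [enorm_zero, ENNReal.zero_rpow_of_neg (by linarith), top_add, ENNReal.mul_top]
    · exact le_top
    · exact mul_ne_zero (by simp) hw0
  obtain ⟨c, hc⟩ := exists_enorm_div_add_rpow_le h0 h1 hu0 (r / w)
  obtain ⟨c', hc'⟩ := exists_enorm_div_add_rpow_le h0 h1 (sub_pos.2 hu.2) (r / w)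
  -- The minimum is one of its two sides; the falling side becomes a rising one under `v ↦ 1 - v`.
  have hpt : ∀ v ∈ Ioo (0 : ℝ) 1, ‖w * min (u / v) ((1 - u) / (1 - v)) + r‖ₑ ^ (-θ)
      ≤ ‖w‖ₑ ^ (-θ) * (2 * ‖u‖ₑ ^ (-θ) * (1 + ‖v - c‖ₑ ^ (-θ))
        + 2 * ‖1 - u‖ₑ ^ (-θ) * (1 + ‖v - (1 - c')‖ₑ ^ (-θ))) := by
    intro v hv
    have heq : w * min (u / v) ((1 - u) / (1 - v)) + r
        = w * (min (u / v) ((1 - u) / (1 - v)) + r / w) := by field_simp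
    rw [heq, enorm_mul_rpow]
    gcongr
    rcases min_choice (u / v) ((1 - u) / (1 - v)) with h | h <;> rw [h]
    · exact (hc v hv).trans le_self_add
    · refine (hc' (1 - v) ⟨by linarith [hv.2], by linarith [hv.1]⟩).trans ?_
      have : ‖1 - v - c'‖ₑ = ‖v - (1 - c')‖ₑ := by rw [← enorm_neg]; ring_nf
      rw [this]
      exact le_add_self
  have hI : ∀ c, ∫⁻ v in Ioo (0 : ℝ) 1, (1 + ‖v - c‖ₑ ^ (-θ)) ≤ 1 + C := by
    intro c
    rw [lintegral_add_left measurable_const]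
    refine add_le_add (by simp) (hCle c)
  refine (setLIntegral_mono' measurableSet_Ioo hpt).trans ?_
  rw [lintegral_const_mul _ (by fun_prop), lintegral_add_left (by fun_prop),
    lintegral_const_mul _ (by fun_prop), lintegral_const_mul _ (by fun_prop)]
  calc _ ≤ ‖w‖ₑ ^ (-θ) * (2 * ‖u‖ₑ ^ (-θ) * (1 + C) + 2 * ‖1 - u‖ₑ ^ (-θ) * (1 + C)) := by
        gcongr <;> exact hI _
    _ = _ := by ring

/-- This averages over the mesh translation the loss near cell boundaries. With `f = fract c`, the
singularities in `τ` lie only at `f` and `f ± 1`. -/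
theorem exists_lintegral_enorm_fract_le {θ : ℝ} (h0 : 0 < θ) (h1 : θ < 1) :
    ∃ C : ℝ≥0∞, C ≠ ∞ ∧ ∀ c : ℝ, ∫⁻ τ in Ioo (0 : ℝ) 1,
      (‖Int.fract (c - τ)‖ₑ ^ (-θ) + ‖1 - Int.fract (c - τ)‖ₑ ^ (-θ)) ≤ C := by
  obtain ⟨C, hC, hCle⟩ := exists_lintegral_enorm_sub_rpow_le h0 h1
  refine ⟨C + C + C, by simp [hC], fun c => ?_⟩
  set f := Int.fract c with hf
  have hpt : ∀ τ ∈ Ioo (0 : ℝ) 1,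
      ‖Int.fract (c - τ)‖ₑ ^ (-θ) + ‖1 - Int.fract (c - τ)‖ₑ ^ (-θ)
      ≤ ‖τ - f‖ₑ ^ (-θ) + ‖τ - (f + 1)‖ₑ ^ (-θ) + ‖τ - (f - 1)‖ₑ ^ (-θ) := by
    intro τ hτ
    have hf0 := Int.fract_nonneg c
    have hf1 := Int.fract_lt_one c
    have hcf : Int.fract (c - τ) = Int.fract (f - τ) := by
      rw [Int.fract_eq_fract]
      exact ⟨⌊c⌋, by rw [hf, Int.fract]; ring⟩
    rcases le_or_gt τ f with h | h
    · have : Int.fract (c - τ) = f - τ := by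
        rw [hcf, Int.fract_eq_self]; constructor <;> linarith [hτ.1]
      rw [this, ← enorm_neg (f - τ), neg_sub, show 1 - (f - τ) = τ - (f - 1) by ring]
      gcongr
      exact le_self_add
    · have : Int.fract (c - τ) = f - τ + 1 := by
        rw [hcf, Int.fract_eq_iff]
        refine ⟨by linarith [hτ.2], by linarith, -1, by simp⟩
      rw [this, ← enorm_neg (f - τ + 1), show -(f - τ + 1) = τ - (f + 1) by ring,
        show 1 - (f - τ + 1) = τ - f by ring, add_comm]
      exact le_self_add
  refine (setLIntegral_mono' measurableSet_Ioo hpt).trans ?_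
  rw [lintegral_add_left (by fun_prop), lintegral_add_left (by fun_prop)]
  exact add_le_add (add_le_add (hCle _) (hCle _)) (hCle _)

/-! ### Uniform vectors and measurability of the series -/

theorem measurableSet_openCube (D : ℕ) (s : ℝ) : MeasurableSet (openCube D s) := by
  have : openCube D s = ⋂ i, {x : Space D | 0 < x i ∧ x i < s} := by ext; simp [openCube]
  rw [this]
  refine MeasurableSet.iInter fun i => ?_
  have hi : Measurable fun x : Space D => x i := by fun_prop
  exact (measurableSet_lt measurable_const hi).inter (measurableSet_lt hi measurable_const)

theorem measurePreserving_coord : MeasurePreserving (fun x : Space 1 => x 0) :=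
  (volume_preserving_funUnique (Fin 1) ℝ).comp (PiLp.volume_preserving_ofLp (Fin 1))

theorem volume_openCube {D : ℕ} {s : ℝ} (hs : 0 < s) :
    volume (openCube D s) = ENNReal.ofReal (s ^ D) := by
  have : openCube D s = (@WithLp.ofLp 2 (Fin D → ℝ)) ⁻¹' (univ.pi fun _ => Ioo 0 s) := by
    ext x; simp [openCube]
  rw [this, (PiLp.volume_preserving_ofLp (Fin D)).measure_preimage
    (MeasurableSet.univ_pi fun _ => measurableSet_Ioo).nullMeasurableSet, volume_pi_pi]
  simp [ENNReal.ofReal_pow hs.le]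

theorem lintegral_coord_div_of_isUniform {Ω : Type*} [MeasurableSpace Ω] {P : Measure Ω}
    {X : Ω → Space 1} {s : ℝ} (hs : 0 < s) (hX : Measurable X)
    (hU : pdf.IsUniform X (openCube 1 s) P volume) {f : ℝ → ℝ≥0∞} (hf : Measurable f) :
    ∫⁻ ω, f (X ω 0 / s) ∂P = ∫⁻ v in Ioo (0 : ℝ) 1, f v := by
  have hs0 : ENNReal.ofReal s ≠ 0 := by simpa using hs
  have hpre : openCube 1 s = (fun x : Space 1 => x 0) ⁻¹' Ioo 0 s := by
    ext x; simp [openCube]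
  have hg : Measurable fun y : ℝ => (Ioo (0 : ℝ) 1).indicator f (y / s) :=
    (hf.indicator measurableSet_Ioo).comp (by fun_prop)
  calc ∫⁻ ω, f (X ω 0 / s) ∂P = ∫⁻ x, f (x 0 / s) ∂(P.map X) :=
        (lintegral_map (f := fun x : Space 1 => f (x 0 / s)) (hf.comp (by fun_prop)) hX).symm
    _ = (ENNReal.ofReal s)⁻¹ * ∫⁻ x in openCube 1 s, f (x 0 / s) := by
        rw [hU, ProbabilityTheory.cond, lintegral_smul_measure, volume_openCube hs, pow_one,
          smul_eq_mul]
    _ = (ENNReal.ofReal s)⁻¹ * ∫⁻ x : Space 1, (Ioo (0 : ℝ) 1).indicator f (x 0 / s) := by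
        rw [← lintegral_indicator (measurableSet_openCube 1 s)]
        congr 2
        funext x
        have : x ∈ openCube 1 s ↔ x 0 / s ∈ Ioo (0 : ℝ) 1 := by
          rw [hpre, mem_preimage, mem_Ioo, mem_Ioo, div_lt_one hs, div_pos_iff_of_pos_right hs]
        by_cases h : x ∈ openCube 1 s
        · rw [indicator_of_mem h, indicator_of_mem (this.1 h)]
        · rw [indicator_of_notMem h, indicator_of_notMem (mt this.2 h)]
    _ = (ENNReal.ofReal s)⁻¹ * ∫⁻ y : ℝ, (Ioo (0 : ℝ) 1).indicator f (y / s) := by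
        rw [measurePreserving_coord.lintegral_comp hg]
    _ = ∫⁻ v in Ioo (0 : ℝ) 1, f v := by
        rw [← lintegral_indicator measurableSet_Ioo]
        conv_rhs => rw [← Real.smul_map_volume_mul_left (inv_ne_zero hs.ne')]
        rw [lintegral_smul_measure, lintegral_map (hf.indicator measurableSet_Ioo) (by fun_prop),
          smul_eq_mul, abs_of_pos (inv_pos.2 hs), ENNReal.ofReal_inv_of_pos hs]
        simp only [div_eq_inv_mul]

section Measurability

variable {D : ℕ} {Ω : Type*} [MeasurableSpace Ω]

theorem measurable_cubeIndex {s : ℝ} {T X : Ω → Space D} (hT : Measurable T) (hX : Measurable X) :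
    Measurable fun ω => cubeIndex s (T ω) (X ω) :=
  measurable_pi_lambda _ fun i => Int.measurable_floor.comp (by fun_prop)

theorem measurable_cubePyramid {s : ℝ} {A C X : Ω → Space D} (hA : Measurable A)
    (hC : Measurable C) (hX : Measurable X) :
    Measurable fun ω => cubePyramid (A ω) s (C ω) (X ω) := by
  have hAi : ∀ i, Measurable fun ω => A ω i := fun i => by fun_prop
  have hXi : ∀ i, Measurable fun ω => X ω i := fun i => by fun_prop
  have hCi : ∀ i, Measurable fun ω => C ω i := fun i => by fun_prop
  unfold cubePyramid
  exact Measurable.iInf fun i =>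
    (((hXi i).sub (hAi i)).div ((hCi i).sub (hAi i))).min
      ((((hAi i).add_const s).sub (hXi i)).div (((hAi i).add_const s).sub (hCi i)))

/-- The random cell index takes countably many values, so measurability for each fixed index
suffices. -/
theorem measurable_layer {s : ℝ} {T X : Ω → Space D} {V : (Fin D → ℤ) → Ω → Space D}
    (hT : Measurable T) (hX : Measurable X) (hV : ∀ k, Measurable (V k)) :
    Measurable fun ω => layer s (T ω) (fun k => V k ω) (X ω) := by
  have hcorner : ∀ k, Measurable fun ω => cubeCorner s (T ω) k := fun k => by
    have : ∀ i, Measurable fun ω => T ω i := fun i => by fun_prop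
    exact (WithLp.measurable_toLp 2 _).comp (measurable_pi_lambda _ fun i => (this i).add_const _)
  have h : Measurable fun p : Ω × (Fin D → ℤ) => cubePyramid (cubeCorner s (T p.1) p.2) s
      (cubeCorner s (T p.1) p.2 + V p.2 p.1) (X p.1) := by
    refine measurable_from_prod_countable_left fun k => ?_
    exact measurable_cubePyramid (hcorner k) ((hcorner k).add (hV k)) hX
  have hi : Measurable fun ω => cubeIndex s (T ω) (X ω) := measurable_cubeIndex hT hX
  have hp : Measurable fun ω => (ω, cubeIndex s (T ω) (X ω)) := measurable_id'.prodMk hi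
  have h2 := h.comp hp
  simp only [Function.comp_def] at h2
  unfold layer
  exact h2

theorem measurable_series [NeZero D] {lam α β : ℝ} (hlam : 1 < lam) (hα : 0 < α)
    {T : ℕ → Ω → Space D} {X : Ω → Space D} {V : ℕ → (Fin D → ℤ) → Ω → Space D}
    (hT : ∀ n, Measurable (T n)) (hX : Measurable X) (hV : ∀ n k, Measurable (V n k))
    (hVc : ∀ n k ω, V n k ω ∈ openCube D (meshSide D lam β n)) :
    Measurable fun ω => series lam α β (fun n => T n ω) (fun n k => V n k ω) (X ω) := by
  refine measurable_of_tendsto_metrizable (f := fun (N : ℕ) ω =>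
    ∑ n ∈ Finset.range N, lam ^ (-(n * α / D)) *
      layer (meshSide D lam β n) (T n ω) (fun k => V n k ω) (X ω)) (fun N => ?_) ?_
  · exact Finset.measurable_sum _ fun n _ => (measurable_layer (hT n) hX (hV n)).const_mul _
  · refine tendsto_pi_nhds.2 fun ω => ?_
    exact (summable_mul_of_mem_Icc hlam hα fun n => layer_mem_Icc (meshSide_pos hlam D β n)
      (fun k => hVc n k ω) _).hasSum.tendsto_sum_nat

end Measurability

/-! ### Conditioning on all variables but one nucleus -/

theorem IndepFun.lintegral_le_lintegral {Ω E E' : Type*} [MeasurableSpace Ω] [MeasurableSpace E]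
    [MeasurableSpace E'] {P : Measure Ω} [IsProbabilityMeasure P] {X : Ω → E} {Y : Ω → E'}
    (hXY : IndepFun X Y P) (hX : Measurable X) (hY : Measurable Y) {G : E × E' → ℝ≥0∞}
    (hG : Measurable G) {H : E' → ℝ≥0∞} (hH : ∀ y, ∫⁻ ω, G (X ω, y) ∂P ≤ H y) :
    ∫⁻ ω, G (X ω, Y ω) ∂P ≤ ∫⁻ ω, H (Y ω) ∂P := by
  have hp := hXY.map_prod_eq_prod_map_map hX.aemeasurable hY.aemeasurable
  have := Measure.isProbabilityMeasure_map (μ := P) hX.aemeasurable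
  have := Measure.isProbabilityMeasure_map (μ := P) hY.aemeasurable
  rw [← lintegral_map (f := G) (g := fun ω => (X ω, Y ω)) hG (hX.prodMk hY), hp,
    lintegral_prod_symm _ hG.aemeasurable,
    lintegral_map (f := fun y => ∫⁻ x, G (x, y) ∂(P.map X)) hG.lintegral_prod_left' hY]
  refine lintegral_mono fun ω => ?_
  rw [lintegral_map (f := fun x => G (x, Y ω)) (hG.comp (by fun_prop)) hX]
  exact hH _

theorem series_eq_add {D : ℕ} [NeZero D] {lam α β : ℝ} (hlam : 1 < lam) (hα : 0 < α)
    {t : ℕ → Space D} {v : ℕ → (Fin D → ℤ) → Space D}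
    (hv : ∀ n k, v n k ∈ openCube D (meshSide D lam β n)) (x : Space D) (n : ℕ) :
    series lam α β t v x = lam ^ (-(n * α / D)) * layer (meshSide D lam β n) (t n) (v n) x
      + ∑' m : ℕ, if m = n then 0 else
        lam ^ (-(m * α / D)) * layer (meshSide D lam β m) (t m) (v m) x :=
  (summable_mul_of_mem_Icc hlam hα fun n => layer_mem_Icc (meshSide_pos hlam D β n)
      (hv n) _).tsum_eq_add_tsum_ite n

theorem layer_one_eq {s : ℝ} (hs : 0 < s) (t : Space 1) (v : (Fin 1 → ℤ) → Space 1) (x : Space 1) :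
    layer s t v x = min (Int.fract ((x 0 - t 0) / s) / (v (cubeIndex s t x) 0 / s))
      ((1 - Int.fract ((x 0 - t 0) / s)) / (1 - v (cubeIndex s t x) 0 / s)) := by
  have h1 : Int.fract ((x 0 - t 0) / s)
      = (x 0 - cubeCorner s t (cubeIndex s t x) 0) / s := by
    simp only [cubeCorner, cubeIndex, Int.fract]
    field_simp
    ring
  unfold layer cubePyramid
  rw [ciInf_unique, h1]
  simp only [Fin.default_eq_zero, PiLp.add_apply]
  generalize cubeCorner s t (cubeIndex s t x) 0 = a
  generalize v (cubeIndex s t x) 0 = w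
  congr 1
  · rw [div_div_div_cancel_right₀ hs.ne', add_sub_cancel_left]
  · rw [one_sub_div hs.ne', one_sub_div hs.ne', div_div_div_cancel_right₀ hs.ne']
    congr 1 <;> ring

theorem abs_sub_lt_of_cubeIndex_eq {s : ℝ} (hs : 0 < s) {t x y : Space 1}
    (h : cubeIndex s t x = cubeIndex s t y) : |x 0 - y 0| < s := by
  have h1 := Int.abs_sub_lt_one_of_floor_eq_floor (congrFun h 0)
  rwa [← sub_div, sub_sub_sub_cancel_right, abs_div, abs_of_pos hs, div_lt_one hs] at h1

theorem lintegral_eq_tsum_ite {Ω ι : Type*} [MeasurableSpace Ω] [Countable ι] [DecidableEq ι]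
    [MeasurableSpace ι] [MeasurableSingletonClass ι] (P : Measure Ω) {K : Ω → ι}
    (hK : Measurable K) {f : Ω → ℝ≥0∞} (hf : Measurable f) :
    ∫⁻ ω, f ω ∂P = ∑' k, ∫⁻ ω, (if K ω = k then f ω else 0) ∂P := by
  have hm : ∀ k, AEMeasurable (fun ω => if K ω = k then f ω else 0) P := fun k =>
    (Measurable.ite (hK (measurableSet_singleton k)) hf measurable_const).aemeasurable
  rw [← lintegral_tsum hm]
  refine lintegral_congr fun ω => ?_
  simp_rw [eq_comm (a := K ω)]
  exact (tsum_ite_eq (K ω) (fun _ => f ω)).symm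

/-- The σ-algebra on `Ω` is left free so that this applies to the one generated by all variables
except a single nucleus. -/
theorem measurable_prodMk_remainder {Ω : Type*} [MeasurableSpace Ω] {lam α β : ℝ} (hlam : 1 < lam)
    (hα : 0 < α) {T : ℕ → Ω → Space 1} {V : ℕ → (Fin 1 → ℤ) → Ω → Space 1}
    (hT : ∀ n, Measurable (T n)) (hV : ∀ n k, Measurable (V n k))
    (hVc : ∀ n k ω, V n k ω ∈ openCube 1 (meshSide 1 lam β n)) (n : ℕ) (s w : ℝ) (x y : Space 1) :
    Measurable fun ω => (T n ω, series lam α β (fun n => T n ω) (fun n k => V n k ω) x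
      - w * layer s (T n ω) (fun k => V n k ω) x
      - series lam α β (fun n => T n ω) (fun n k => V n k ω) y) :=
  (hT n).prodMk (((measurable_series hlam hα hT measurable_const hV hVc).sub
    ((measurable_layer (hT n) measurable_const (hV n)).const_mul w)).sub
    (measurable_series hlam hα hT measurable_const hV hVc))

/-- The family `v` with the nucleus of the cube of index `k` of generation `n` put at `c`. -/
def replaceNucleus {D : ℕ} {Ω : Type*} (V : ℕ → (Fin D → ℤ) → Ω → Space D) (n : ℕ)
    (k : Fin D → ℤ) (c : Space D) (m : ℕ) (l : Fin D → ℤ) : Ω → Space D :=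
  if (m, l) = (n, k) then fun _ => c else V m l

theorem exists_indep_measurableSpace {Ω : Type*} [mΩ : MeasurableSpace Ω] {P : Measure Ω}
    {D : ℕ} {T : ℕ → Ω → Space D} {V : ℕ → (Fin D → ℤ) → Ω → Space D}
    (hT : ∀ n, Measurable (T n)) (hV : ∀ n k, Measurable (V n k))
    (hind : iIndepFun (Sum.elim T (fun p : ℕ × (Fin D → ℤ) => V p.1 p.2)) P)
    (n : ℕ) (k : Fin D → ℤ) (c : Space D) :
    ∃ m' : MeasurableSpace Ω, m' ≤ mΩ ∧ (∀ m, Measurable[m'] (T m)) ∧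
      (∀ m l, Measurable[m'] (replaceNucleus V n k c m l)) ∧
      Indep (MeasurableSpace.comap (V n k) inferInstance) m' P := by
  set X := Sum.elim T (fun p : ℕ × (Fin D → ℤ) => V p.1 p.2) with hX
  set i₀ : ℕ ⊕ ℕ × (Fin D → ℤ) := Sum.inr (n, k) with hi₀
  have hXmeas : ∀ i, Measurable (X i) := by
    rintro (m | ⟨m, l⟩)
    exacts [hT m, hV m l]
  have hle : ∀ i, MeasurableSpace.comap (X i) inferInstance ≤ mΩ := fun i => (hXmeas i).comap_le
  have hI := indep_iSup_of_disjoint hle hind (disjoint_compl_right (a := ({i₀} : Set _)))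
  have hXm : ∀ i ≠ i₀, MeasurableSpace.comap (X i) inferInstance
      ≤ ⨆ i ∈ ({i₀}ᶜ : Set _), MeasurableSpace.comap (X i) inferInstance := fun i hi =>
    le_iSup₂_of_le (f := fun i (_ : i ∈ ({i₀}ᶜ : Set _)) =>
      MeasurableSpace.comap (X i) inferInstance) i hi le_rfl
  refine ⟨_, iSup₂_le fun i _ => hle i, fun m => ?_, fun m l => ?_,
    indep_of_indep_of_le_left hI ?_⟩
  · exact measurable_iff_comap_le.2 (hXm (Sum.inl m) (by simp [hi₀]))
  · by_cases h : (m, l) = (n, k)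
    · rw [replaceNucleus, if_pos h]; exact measurable_const
    · rw [replaceNucleus, if_neg h]
      exact measurable_iff_comap_le.2 (hXm (Sum.inr (m, l)) fun hc => h (Sum.inr_injective hc))
  · exact le_iSup₂_of_le (f := fun i (_ : i ∈ ({i₀} : Set _)) =>
      MeasurableSpace.comap (X i) inferInstance) i₀ rfl le_rfl

/-- Only the nucleus of the cell of `x` is integrated first; the other layers, and the value at `y`,
enter through an independent additive constant. Integrating over `T n` then bounds the remaining
boundary singularity. -/
theorem exists_lintegral_series_sub_rpow_le {Ω : Type*} [MeasurableSpace Ω] {P : Measure Ω}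
    [IsProbabilityMeasure P] {lam α β : ℝ} (hlam : 1 < lam) (hα : 0 < α)
    {T : ℕ → Ω → Space 1} {V : ℕ → (Fin 1 → ℤ) → Ω → Space 1}
    (hT : ∀ n, Measurable (T n)) (hV : ∀ n k, Measurable (V n k))
    (hVc : ∀ n k ω, V n k ω ∈ openCube 1 (meshSide 1 lam β n))
    (hTU : ∀ n, pdf.IsUniform (T n) (openCube 1 (meshSide 1 lam β n)) P volume)
    (hVU : ∀ n k, pdf.IsUniform (V n k) (openCube 1 (meshSide 1 lam β n)) P volume)
    (hind : iIndepFun (Sum.elim T (fun p : ℕ × (Fin 1 → ℤ) => V p.1 p.2)) P)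
    {θ : ℝ} (h0 : 0 < θ) (h1 : θ < 1) :
    ∃ K : ℝ≥0∞, K ≠ ∞ ∧ ∀ (n : ℕ) (x y : Space 1), meshSide 1 lam β n ≤ |x 0 - y 0| →
      ∫⁻ ω, ‖series lam α β (fun n => T n ω) (fun n k => V n k ω) x
        - series lam α β (fun n => T n ω) (fun n k => V n k ω) y‖ₑ ^ (-θ) ∂P
      ≤ K * ‖lam ^ (-(n * α / (1 : ℕ)))‖ₑ ^ (-θ) := by
  obtain ⟨C₁, hC₁, hC₁le⟩ := exists_lintegral_enorm_tent_le h0 h1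
  obtain ⟨C₂, hC₂, hC₂le⟩ := exists_lintegral_enorm_fract_le h0 h1
  refine ⟨C₁ * C₂, ENNReal.mul_ne_top hC₁ hC₂, fun n x y hxy => ?_⟩
  set s := meshSide 1 lam β n with hs_def
  have hs : 0 < s := meshSide_pos hlam 1 β n
  set w : ℝ := lam ^ (-(n * α / (1 : ℕ))) with hw_def
  have hw : 0 < w := Real.rpow_pos_of_pos (by linarith) _
  set F : Space 1 → Ω → ℝ := fun z ω => series lam α β (fun n => T n ω) (fun n k => V n k ω) z
  let pot : Space 1 → ℝ≥0∞ := fun t => C₁ * ‖w‖ₑ ^ (-θ) *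
    (‖Int.fract ((x 0 - t 0) / s)‖ₑ ^ (-θ) + ‖1 - Int.fract ((x 0 - t 0) / s)‖ₑ ^ (-θ))
  -- The cell of `x` is random; on each event that its index is `k`, the relevant nucleus is the
  -- fixed variable `V n k`.
  have hcell : ∀ k : Fin 1 → ℤ,
      ∫⁻ ω, (if cubeIndex s (T n ω) x = k then ‖F x ω - F y ω‖ₑ ^ (-θ) else 0) ∂P
        ≤ ∫⁻ ω, (if cubeIndex s (T n ω) x = k then pot (T n ω) else 0) ∂P := by
    intro k
    -- Any deterministic point of the open cell would do: it keeps the layers in `[0, 1]`, hence the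
    -- series summable.
    set c : Space 1 := WithLp.toLp 2 fun _ => s / 2 with hc_def
    set V' := replaceNucleus V n k c with hV'
    have hV'c : ∀ m l ω, V' m l ω ∈ openCube 1 (meshSide 1 lam β m) := by
      intro m l ω
      by_cases h : (m, l) = (n, k)
      · obtain ⟨rfl, rfl⟩ := Prod.mk.inj h
        rw [hV', replaceNucleus, if_pos rfl]
        exact fun i => ⟨half_pos hs, half_lt_self hs⟩
      · rw [hV', replaceNucleus, if_neg h]; exact hVc m l ω
    set R : Ω → ℝ := fun ω => series lam α β (fun n => T n ω) (fun n k => V' n k ω) x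
      - w * layer s (T n ω) (fun k => V' n k ω) x
      - series lam α β (fun n => T n ω) (fun n k => V' n k ω) y with hR
    set Y : Ω → Space 1 × ℝ := fun ω => (T n ω, R ω) with hYdef
    obtain ⟨hY, hXY⟩ : Measurable Y ∧ IndepFun (V n k) Y P := by
      obtain ⟨m', hm'le, hTm, hV'm, hI⟩ := exists_indep_measurableSpace hT hV hind n k c
      have hYm : Measurable[m'] Y :=
        measurable_prodMk_remainder hlam hα hTm hV'm hV'c n s w x y
      refine ⟨hYm.mono hm'le le_rfl, ?_⟩
      rw [IndepFun_iff_Indep]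
      exact indep_of_indep_of_le_right hI hYm.comap_le
    let G : Space 1 × (Space 1 × ℝ) → ℝ≥0∞ := fun p =>
      if cubeIndex s p.2.1 x = k then
        ‖w * min (Int.fract ((x 0 - p.2.1 0) / s) / (p.1 0 / s))
          ((1 - Int.fract ((x 0 - p.2.1 0) / s)) / (1 - p.1 0 / s)) + p.2.2‖ₑ ^ (-θ) else 0
    have hG : Measurable G := by
      have hp1 : Measurable fun p : Space 1 × (Space 1 × ℝ) => p.1 0 := by fun_prop
      have hp2 : Measurable fun p : Space 1 × (Space 1 × ℝ) => p.2.1 0 := by fun_prop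
      refine Measurable.ite ?_ ?_ measurable_const
      · exact (measurable_cubeIndex (by fun_prop) measurable_const) (measurableSet_singleton k)
      · fun_prop
    have hH : ∀ q : Space 1 × ℝ, ∫⁻ ω, G (V n k ω, q) ∂P
        ≤ (fun q : Space 1 × ℝ => if cubeIndex s q.1 x = k then pot q.1 else 0) q := by
      rintro ⟨t, r⟩
      by_cases ht : cubeIndex s t x = k
      · simp only [G, if_pos ht, pot]
        rw [lintegral_coord_div_of_isUniform (f := fun v =>
          ‖w * min (Int.fract ((x 0 - t 0) / s) / v)
          ((1 - Int.fract ((x 0 - t 0) / s)) / (1 - v)) + r‖ₑ ^ (-θ)) hs (hV n k) (hVU n k)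
          (by fun_prop)]
        exact hC₁le _ ⟨Int.fract_nonneg _, Int.fract_lt_one _⟩ w hw r
      · simp [G, if_neg ht]
    refine le_trans (le_of_eq ?_) (IndepFun.lintegral_le_lintegral hXY (hV n k) hY hG hH)
    refine lintegral_congr fun ω => ?_
    by_cases ht : cubeIndex s (T n ω) x = k
    swap
    · simp [G, Y, if_neg ht]
    simp only [G, Y, if_pos ht]
    -- Two points of one cell are closer than `s`, so `F y` does not depend on the nucleus being
    -- integrated.
    have hyk : cubeIndex s (T n ω) y ≠ k := fun hc =>
      absurd (abs_sub_lt_of_cubeIndex_eq hs (ht.trans hc.symm)) (not_lt.2 hxy)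
    have hFy : F y ω = series lam α β (fun n => T n ω) (fun n k => V' n k ω) y := by
      refine tsum_congr fun m => ?_
      have : V' m (cubeIndex (meshSide 1 lam β m) (T m ω) y)
          = V m (cubeIndex (meshSide 1 lam β m) (T m ω) y) := by
        refine if_neg fun hc => ?_
        obtain ⟨hm, hl⟩ := Prod.mk.inj hc
        subst hm
        exact hyk hl
      simp only [layer, this]
    have hFx : F x ω = w * layer s (T n ω) (fun k => V n k ω) x
        + (series lam α β (fun n => T n ω) (fun n k => V' n k ω) x
          - w * layer s (T n ω) (fun k => V' n k ω) x) := by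
      rw [series_eq_add hlam hα (t := fun n => T n ω) (fun m l => hV'c m l ω) x n, add_sub_cancel_left]
      simp only [F]
      rw [series_eq_add hlam hα (t := fun n => T n ω) (fun m l => hVc m l ω) x n]
      congr 1
      refine tsum_congr fun m => ?_
      by_cases hmn : m = n
      · simp [hmn]
      · have : ∀ l, V' m l = V m l := fun l => if_neg fun hc => hmn (Prod.mk.inj hc).1
        simp only [if_neg hmn, this]
    rw [hFx, hFy, layer_one_eq hs, ht]
    congr 2
    simp only [R]
    ring
  have hidx : Measurable fun ω => cubeIndex s (T n ω) x :=
    measurable_cubeIndex (hT n) measurable_const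
  have hFm : ∀ z, Measurable (F z) := fun z =>
    measurable_series hlam hα hT measurable_const hV hVc
  have hpot : Measurable pot := by
    have : Measurable fun t : Space 1 => t 0 := by fun_prop
    fun_prop
  calc ∫⁻ ω, ‖F x ω - F y ω‖ₑ ^ (-θ) ∂P
      = ∑' k, ∫⁻ ω, (if cubeIndex s (T n ω) x = k then ‖F x ω - F y ω‖ₑ ^ (-θ) else 0) ∂P :=
        lintegral_eq_tsum_ite P hidx (((hFm x).sub (hFm y)).enorm.pow_const _)
    _ ≤ ∑' k, ∫⁻ ω, (if cubeIndex s (T n ω) x = k then pot (T n ω) else 0) ∂P :=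
        ENNReal.tsum_le_tsum hcell
    _ = ∫⁻ ω, pot (T n ω) ∂P := (lintegral_eq_tsum_ite P hidx (hpot.comp (hT n))).symm
    _ = C₁ * ‖w‖ₑ ^ (-θ) * ∫⁻ τ in Ioo (0 : ℝ) 1, (‖Int.fract (x 0 / s - τ)‖ₑ ^ (-θ)
          + ‖1 - Int.fract (x 0 / s - τ)‖ₑ ^ (-θ)) := by
        rw [← lintegral_const_mul _ (by fun_prop),
          ← lintegral_coord_div_of_isUniform (f := fun τ => C₁ * ‖w‖ₑ ^ (-θ) *
            (‖Int.fract (x 0 / s - τ)‖ₑ ^ (-θ) + ‖1 - Int.fract (x 0 / s - τ)‖ₑ ^ (-θ)))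
            hs (hT n) (hTU n) (by fun_prop)]
        simp only [pot, sub_div]
    _ ≤ C₁ * ‖w‖ₑ ^ (-θ) * C₂ := by gcongr; exact hC₂le _
    _ = _ := by ring

/-! ### From mean potentials to the dimension of the graph -/

/-- At the first mesh side below `h` the amplitude is comparable to `h^(α/β)`; the factor `lam^(-α)`
is the loss of one generation. -/
theorem exists_meshSide_le {lam α β : ℝ} (hlam : 1 < lam) (hα : 0 < α) (hβ : 0 < β) {h : ℝ}
    (h0 : 0 < h) (h1 : h ≤ 1) :
    ∃ n : ℕ, meshSide 1 lam β n ≤ h ∧ lam ^ (-α) * h ^ (α / β) ≤ lam ^ (-(n * α / (1 : ℕ))) := by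
  have hl0 : 0 < lam := by linarith
  obtain ⟨n, hn1, hn2⟩ := exists_nat_pow_near_of_lt_one h0 h1
    (Real.rpow_pos_of_pos hl0 (-(β / (1 : ℕ))))
    (Real.rpow_lt_one_of_one_lt_of_neg hlam (by simpa using hβ))
  refine ⟨n + 1, ?_, ?_⟩
  · rw [meshSide, rpow_neg_natCast_mul_div lam hlam]
    exact hn1.le
  · have h3 : h ^ (α / β) ≤ lam ^ (-(n * α)) := by
      refine (Real.rpow_le_rpow h0.le hn2 (by positivity)).trans (le_of_eq ?_)
      rw [← Real.rpow_natCast, ← Real.rpow_mul hl0.le, ← Real.rpow_mul hl0.le]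
      congr 1
      push_cast
      field_simp
    calc lam ^ (-α) * h ^ (α / β) ≤ lam ^ (-α) * lam ^ (-(n * α)) := by gcongr
      _ = _ := by
        rw [← Real.rpow_add hl0]
        congr 1
        push_cast
        ring

/-- The parametrization of the graph of a function above the line. -/
def graphMap (F : Space 1 → ℝ) (x : ℝ) : WithLp 2 (Space 1 × ℝ) :=
  WithLp.toLp 2 (WithLp.toLp 2 fun _ => x, F (WithLp.toLp 2 fun _ => x))

/-- The distance dominates both its vertical and its horizontal part, so the exponent can be split
between them. -/
theorem edist_graphMap_rpow_le (F : Space 1 → ℝ) {θ δ : ℝ} (hθ : 0 < θ) (hδ : 0 ≤ δ) (x y : ℝ) :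
    edist (graphMap F x) (graphMap F y) ^ (-(θ + δ))
      ≤ ‖F (WithLp.toLp 2 fun _ => x) - F (WithLp.toLp 2 fun _ => y)‖ₑ ^ (-θ) * ‖x - y‖ₑ ^ (-δ) := by
  rcases eq_or_ne x y with rfl | hne
  · rw [sub_self, sub_self, enorm_zero, ENNReal.zero_rpow_of_neg (by linarith), ENNReal.top_mul]
    · exact le_top
    · rcases hδ.eq_or_lt with rfl | hδ
      · simp
      · rw [ENNReal.zero_rpow_of_neg (by linarith)]; simp
  have hx : ‖x - y‖ₑ ≤ edist (graphMap F x) (graphMap F y) := by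
    have h1 := WithLp.edist_fst_le (p := 2) (graphMap F x) (graphMap F y)
    refine le_trans ?_ h1
    rw [← edist_eq_enorm_sub]
    have := PiLp.edist_apply_le (p := 2) (graphMap F x).fst (graphMap F y).fst 0
    exact this
  have hF : ‖F (WithLp.toLp 2 fun _ => x) - F (WithLp.toLp 2 fun _ => y)‖ₑ
      ≤ edist (graphMap F x) (graphMap F y) := by
    rw [← edist_eq_enorm_sub]
    exact WithLp.edist_snd_le (p := 2) (graphMap F x) (graphMap F y)
  set e := edist (graphMap F x) (graphMap F y)
  have he0 : e ≠ 0 := fun h => by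
    rw [h, nonpos_iff_eq_zero, enorm_eq_zero, sub_eq_zero] at hx
    exact hne hx
  have het : e ≠ ∞ := edist_ne_top _ _
  rw [neg_add, ENNReal.rpow_add _ _ he0 het]
  simp only [ENNReal.rpow_neg]
  gcongr

/-- By Tonelli the energy of Lebesgue measure on `(0, 1)` has finite mean when `η < 1`, hence is
finite almost surely. -/
theorem ae_le_dimH_image_of_lintegral_le {Ω X : Type*} [MeasurableSpace Ω] {P : Measure Ω}
    [IsProbabilityMeasure P] [EMetricSpace X] [MeasurableSpace X] [BorelSpace X]
    [SecondCountableTopology X] {g : Ω → ℝ → X} (hgm : Measurable fun p : Ω × ℝ => g p.1 p.2)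
    {σ η : ℝ} (hσ : 0 < σ) (hη0 : 0 < η) (hη1 : η < 1) {K : ℝ≥0∞} (hK : K ≠ ∞)
    (hle : ∀ x ∈ Ioo (0 : ℝ) 1, ∀ y ∈ Ioo (0 : ℝ) 1, x ≠ y →
      ∫⁻ ω, edist (g ω x) (g ω y) ^ (-σ) ∂P ≤ K * ‖y - x‖ₑ ^ (-η)) :
    ∀ᵐ ω ∂P, ENNReal.ofReal σ ≤ dimH (g ω '' Ioo 0 1) := by
  obtain ⟨C, hC, hCle⟩ := exists_lintegral_enorm_sub_rpow_le hη0 hη1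
  set ν := (volume : Measure ℝ).restrict (Ioo 0 1) with hν
  have hm1 : Measurable fun p : Ω × (ℝ × ℝ) => g p.1 p.2.1 := by
    have hp : Measurable fun p : Ω × (ℝ × ℝ) => (p.1, p.2.1) := by fun_prop
    exact hgm.comp hp
  have hm2 : Measurable fun p : Ω × (ℝ × ℝ) => g p.1 p.2.2 := by
    have hp : Measurable fun p : Ω × (ℝ × ℝ) => (p.1, p.2.2) := by fun_prop
    exact hgm.comp hp
  have hker : Measurable fun p : Ω × (ℝ × ℝ) => edist (g p.1 p.2.1) (g p.1 p.2.2) ^ (-σ) :=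
    (hm1.edist hm2).pow_const _
  have hE : ∫⁻ ω, ∫⁻ p, edist (g ω p.1) (g ω p.2) ^ (-σ) ∂(ν.prod ν) ∂P ≠ ∞ := by
    rw [lintegral_lintegral_swap hker.aemeasurable]
    refine ne_of_lt (lt_of_le_of_lt (b := ∫⁻ p, K * ‖p.2 - p.1‖ₑ ^ (-η) ∂(ν.prod ν)) ?_ ?_)
    · have hae : ∀ᵐ p ∂(ν.prod ν), p.1 ∈ Ioo (0 : ℝ) 1 ∧ p.2 ∈ Ioo (0 : ℝ) 1 ∧ p.1 ≠ p.2 := by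
        rw [Measure.ae_prod_iff_ae_ae]
        · filter_upwards [ae_restrict_mem measurableSet_Ioo] with x hx
          have hne : ∀ᵐ y ∂ν, x ≠ y := by
            refine ae_restrict_of_ae ?_
            simp [ae_iff]
          filter_upwards [ae_restrict_mem measurableSet_Ioo, hne] with y hy hxy
          exact ⟨hx, hy, hxy⟩
        · exact (measurable_fst measurableSet_Ioo).inter ((measurable_snd measurableSet_Ioo).inter
            (measurableSet_eq_fun measurable_fst measurable_snd).compl)
      refine lintegral_mono_ae ?_
      filter_upwards [hae] with p hp
      exact hle p.1 hp.1 p.2 hp.2.1 hp.2.2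
    · rw [lintegral_prod _ (by fun_prop)]
      calc ∫⁻ x, ∫⁻ y, K * ‖y - x‖ₑ ^ (-η) ∂ν ∂ν ≤ ∫⁻ _, K * C ∂ν := by
            refine lintegral_mono fun x => ?_
            rw [lintegral_const_mul _ (by fun_prop)]
            gcongr
            exact hCle x
        _ < ∞ := by
            rw [lintegral_const]
            exact ENNReal.mul_lt_top (ENNReal.mul_lt_top hK.lt_top hC.lt_top) (measure_lt_top _ _)
  filter_upwards [ae_lt_top hker.lintegral_prod_right' hE] with ω hω
  have hkω : Measurable fun p : ℝ × ℝ => edist (g ω p.1) (g ω p.2) ^ (-σ) :=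
    hker.comp measurable_prodMk_left
  rw [lintegral_prod _ hkω.aemeasurable] at hω
  have hν0 : ν ≠ 0 := by
    rw [← Measure.measure_univ_ne_zero, hν, Measure.restrict_apply_univ]
    simp
  have hνc : ν (Ioo 0 1)ᶜ = 0 := by
    rw [hν, Measure.restrict_apply measurableSet_Ioo.compl]
    simp
  exact le_dimH_image_of_energy_lt_top (ν := ν) (hgm.comp measurable_prodMk_left) hνc hν0
    (s := σ.toNNReal) (Real.toNNReal_pos.2 hσ) (by rwa [Real.coe_toNNReal _ hσ.le])

section

variable {Ω : Type*} [MeasurableSpace Ω] {P : Measure Ω} [IsProbabilityMeasure P]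
  {lam α β : ℝ} {T : ℕ → Ω → Space 1} {V : ℕ → (Fin 1 → ℤ) → Ω → Space 1}

theorem exists_lintegral_series_sub_rpow_le_abs_sub (hlam : 1 < lam) (hα : 0 < α) (hβ : 0 < β)
    (hT : ∀ n, Measurable (T n)) (hV : ∀ n k, Measurable (V n k))
    (hVc : ∀ n k ω, V n k ω ∈ openCube 1 (meshSide 1 lam β n))
    (hTU : ∀ n, pdf.IsUniform (T n) (openCube 1 (meshSide 1 lam β n)) P volume)
    (hVU : ∀ n k, pdf.IsUniform (V n k) (openCube 1 (meshSide 1 lam β n)) P volume)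
    (hind : iIndepFun (Sum.elim T (fun p : ℕ × (Fin 1 → ℤ) => V p.1 p.2)) P)
    {θ : ℝ} (h0 : 0 < θ) (h1 : θ < 1) :
    ∃ K : ℝ≥0∞, K ≠ ∞ ∧ ∀ x y : Space 1, x 0 ≠ y 0 → |x 0 - y 0| ≤ 1 →
      ∫⁻ ω, ‖series lam α β (fun n => T n ω) (fun n k => V n k ω) x
        - series lam α β (fun n => T n ω) (fun n k => V n k ω) y‖ₑ ^ (-θ) ∂P
      ≤ K * ‖x 0 - y 0‖ₑ ^ (-(α / β * θ)) := by
  have hl0 : 0 < lam := by linarith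
  obtain ⟨K, hK, hKle⟩ := exists_lintegral_series_sub_rpow_le hlam hα hT hV hVc hTU hVU hind h0 h1
  have hc : 0 < lam ^ (-α) := Real.rpow_pos_of_pos hl0 _
  refine ⟨K * ‖lam ^ (-α)‖ₑ ^ (-θ), ENNReal.mul_ne_top hK ?_, fun x y hxy hle => ?_⟩
  · exact ENNReal.rpow_ne_top_of_ne_zero (by simpa using hc.ne') (by simp)
  have hpos : 0 < |x 0 - y 0| := abs_pos.2 (sub_ne_zero.2 hxy)
  obtain ⟨n, hn, hw⟩ := exists_meshSide_le hlam hα hβ hpos hle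
  refine (hKle n x y hn).trans ?_
  rw [mul_assoc]
  gcongr
  calc ‖lam ^ (-(n * α / (1 : ℕ)))‖ₑ ^ (-θ)
      ≤ ‖lam ^ (-α) * |x 0 - y 0| ^ (α / β)‖ₑ ^ (-θ) := by
        refine enorm_rpow_neg_le_of_le h0.le ?_
        rwa [abs_of_pos (mul_pos hc (Real.rpow_pos_of_pos hpos _)),
          abs_of_pos (Real.rpow_pos_of_pos hl0 _)]
    _ = _ := by
        rw [enorm_mul_rpow, Real.enorm_of_nonneg (r := |x 0 - y 0| ^ (α / β)) (by positivity),
          ← ENNReal.ofReal_rpow_of_pos hpos, ← Real.norm_eq_abs, ofReal_norm, ← ENNReal.rpow_mul]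
        ring_nf

theorem measurable_graphMap_series (hlam : 1 < lam) (hα : 0 < α)
    (hT : ∀ n, Measurable (T n)) (hV : ∀ n k, Measurable (V n k))
    (hVc : ∀ n k ω, V n k ω ∈ openCube 1 (meshSide 1 lam β n)) :
    Measurable fun p : Ω × ℝ =>
      graphMap (series lam α β (fun n => T n p.1) (fun n k => V n k p.1)) p.2 := by
  have hpt : Measurable fun p : Ω × ℝ => (WithLp.toLp 2 fun _ => p.2 : Space 1) :=
    (WithLp.measurable_toLp 2 _).comp (measurable_pi_lambda _ fun i => measurable_snd)
  have hser := measurable_series (Ω := Ω × ℝ) (D := 1) (β := β) hlam hα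
    (T := fun n p => T n p.1) (V := fun n k p => V n k p.1)
    (fun n => (hT n).comp measurable_fst) hpt
    (fun n k => (hV n k).comp measurable_fst) (fun n k p => hVc n k p.1)
  have h2 := (WithLp.measurable_toLp 2 (Space 1 × ℝ)).comp (hpt.prodMk hser)
  simp only [Function.comp_def] at h2
  unfold graphMap
  exact h2

theorem ae_le_dimH_graphOnCube (hlam : 1 < lam) (hα : 0 < α) (hαβ : α ≤ β)
    (hT : ∀ n, Measurable (T n)) (hV : ∀ n k, Measurable (V n k))
    (hVc : ∀ n k ω, V n k ω ∈ openCube 1 (meshSide 1 lam β n))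
    (hTU : ∀ n, pdf.IsUniform (T n) (openCube 1 (meshSide 1 lam β n)) P volume)
    (hVU : ∀ n k, pdf.IsUniform (V n k) (openCube 1 (meshSide 1 lam β n)) P volume)
    (hind : iIndepFun (Sum.elim T (fun p : ℕ × (Fin 1 → ℤ) => V p.1 p.2)) P)
    {θ : ℝ} (h0 : 0 < θ) (h1 : θ < 1) :
    ∀ᵐ ω ∂P, ENNReal.ofReal (θ + (1 - α / β)) ≤
      dimH (graphOnCube (series lam α β (fun n => T n ω) (fun n k => V n k ω))) := by
  have hβ : 0 < β := by linarith
  have hγ0 : 0 < α / β := by positivity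
  have hγ1 : α / β ≤ 1 := (div_le_one hβ).2 hαβ
  set γ := α / β with hγ
  have hη0 : 0 < γ * θ + (1 - γ) := by nlinarith
  -- The gap is `γ(1 - θ)`, positive because `θ < 1`.
  have hη1 : γ * θ + (1 - γ) < 1 := by nlinarith
  obtain ⟨K, hK, hKle⟩ :=
    exists_lintegral_series_sub_rpow_le_abs_sub hlam hα hβ hT hV hVc hTU hVU hind h0 h1
  have hg := measurable_graphMap_series hlam hα hT hV hVc
  have hdim := ae_le_dimH_image_of_lintegral_le (P := P)
    (g := fun ω => graphMap (series lam α β (fun n => T n ω) (fun n k => V n k ω))) hg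
    (σ := θ + (1 - γ)) (by linarith) hη0 hη1 hK fun x hx y hy hne => ?_
  · filter_upwards [hdim] with ω hω
    refine hω.trans (dimH_mono ?_)
    rintro _ ⟨x, hx, rfl⟩
    exact ⟨WithLp.toLp 2 fun _ => x, fun _ => ⟨hx.1.le, hx.2.le⟩, rfl⟩
  calc ∫⁻ ω, edist (graphMap (series lam α β (fun n => T n ω) (fun n k => V n k ω)) x)
        (graphMap (series lam α β (fun n => T n ω) (fun n k => V n k ω)) y) ^ (-(θ + (1 - γ))) ∂P
      ≤ ∫⁻ ω, ‖series lam α β (fun n => T n ω) (fun n k => V n k ω) (WithLp.toLp 2 fun _ => x)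
        - series lam α β (fun n => T n ω) (fun n k => V n k ω) (WithLp.toLp 2 fun _ => y)‖ₑ
          ^ (-θ) * ‖x - y‖ₑ ^ (-(1 - γ)) ∂P :=
        lintegral_mono fun ω => edist_graphMap_rpow_le _ h0 (by linarith) x y
    _ ≤ K * ‖x - y‖ₑ ^ (-(γ * θ)) * ‖x - y‖ₑ ^ (-(1 - γ)) := by
        rw [lintegral_mul_const']
        · gcongr
          refine hKle _ _ hne ?_
          exact abs_sub_le_iff.2 ⟨by linarith [hx.2, hy.1], by linarith [hx.1, hy.2]⟩
        · exact ENNReal.rpow_ne_top_of_ne_zero (by simpa [sub_eq_zero] using hne) (by simp)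
    _ = K * ‖y - x‖ₑ ^ (-(γ * θ + (1 - γ))) := by
        rw [mul_assoc, ← ENNReal.rpow_add _ _ (by simpa [sub_eq_zero] using hne) (by simp),
          ← neg_add, ← enorm_neg, neg_sub]

end

/-! ### Passing to measurable modifications and `θ → 1` -/

theorem aemeasurable_of_isUniform_openCube {Ω : Type*} [MeasurableSpace Ω] {P : Measure Ω} {D : ℕ}
    {X : Ω → Space D} {s : ℝ} (hs : 0 < s) (hU : pdf.IsUniform X (openCube D s) P volume) :
    AEMeasurable X P := by
  refine hU.aemeasurable ?_ ?_ <;> rw [volume_openCube hs]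
  · simpa using pow_pos hs D
  · exact ENNReal.ofReal_ne_top

theorem ae_mem_openCube_of_isUniform {Ω : Type*} [MeasurableSpace Ω] {P : Measure Ω} {D : ℕ}
    {X : Ω → Space D} {s : ℝ} (hs : 0 < s) (hU : pdf.IsUniform X (openCube D s) P volume) :
    ∀ᵐ ω ∂P, X ω ∈ openCube D s := by
  have hX := aemeasurable_of_isUniform_openCube hs hU
  refine ae_of_ae_map hX (p := fun x => x ∈ openCube D s) ?_
  rw [hU]
  exact ae_cond_mem (measurableSet_openCube D s)

/-- A uniform random point of a cube agrees almost surely with a measurable one that lies in the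
cube everywhere. -/
theorem exists_measurable_modification {Ω : Type*} [MeasurableSpace Ω] {P : Measure Ω} {D : ℕ}
    {X : Ω → Space D} {s : ℝ} (hs : 0 < s) (hU : pdf.IsUniform X (openCube D s) P volume) :
    ∃ Y : Ω → Space D, Measurable Y ∧ (∀ ω, Y ω ∈ openCube D s) ∧ X =ᵐ[P] Y := by
  have hX := aemeasurable_of_isUniform_openCube hs hU
  obtain ⟨Y, hY, hYmem, hXY⟩ := hX.exists_ae_eq_range_subset
    (ae_mem_openCube_of_isUniform hs hU) ⟨WithLp.toLp 2 fun _ => s / 2,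
      fun _ => ⟨half_pos hs, half_lt_self hs⟩⟩
  exact ⟨Y, hY, fun ω => hYmem (mem_range_self ω), hXY⟩

theorem isUniform_congr {Ω E : Type*} [MeasurableSpace Ω] [MeasurableSpace E] {P : Measure Ω}
    {μ : Measure E} {X Y : Ω → E} {S : Set E} (hU : pdf.IsUniform X S P μ) (h : X =ᵐ[P] Y) :
    pdf.IsUniform Y S P μ := by
  rw [pdf.IsUniform, ← hU]
  exact (Measure.map_congr h).symm

theorem ae_le_dimH_graphOnCube_series {Ω : Type*} [MeasurableSpace Ω] {P : Measure Ω}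
    [IsProbabilityMeasure P] {lam α β : ℝ} (hlam : 1 < lam) (hα : 0 < α) (hαβ : α ≤ β)
    {T : ℕ → Ω → Space 1} {V : ℕ → (Fin 1 → ℤ) → Ω → Space 1}
    (hT : ∀ n, pdf.IsUniform (T n) (openCube 1 (meshSide 1 lam β n)) P volume)
    (hV : ∀ n k, pdf.IsUniform (V n k) (openCube 1 (meshSide 1 lam β n)) P volume)
    (hind : iIndepFun (Sum.elim T (fun p : ℕ × (Fin 1 → ℤ) => V p.1 p.2)) P) :
    ∀ᵐ ω ∂P, ENNReal.ofReal (2 - α / β) ≤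
      dimH (graphOnCube (series lam α β (fun n => T n ω) (fun n k => V n k ω))) := by
  have hs := meshSide_pos hlam 1 β
  choose T' hT'm hT'c hTT' using fun n => exists_measurable_modification (hs n) (hT n)
  choose V' hV'm hV'c hVV' using fun n k => exists_measurable_modification (hs n) (hV n k)
  have hind' : iIndepFun (Sum.elim T' (fun p : ℕ × (Fin 1 → ℤ) => V' p.1 p.2)) P := by
    refine hind.congr ?_
    rintro (m | ⟨m, l⟩)
    exacts [hTT' m, hVV' m l]
  -- The values `θ = 1 - 1/(m+2)` lie in `(0, 1)` and tend to 1; being countably many, they share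
  -- one null set.
  have key : ∀ᵐ ω ∂P, ∀ m : ℕ, ENNReal.ofReal (1 - 1 / ((m : ℝ) + 2) + (1 - α / β)) ≤
      dimH (graphOnCube (series lam α β (fun n => T' n ω) (fun n k => V' n k ω))) := by
    refine ae_all_iff.2 fun m => ?_
    have hm : (0 : ℝ) < (m : ℝ) + 2 := by positivity
    have h1 : 1 / ((m : ℝ) + 2) < 1 := by
      rw [div_lt_one hm]; linarith [(Nat.cast_nonneg m : (0 : ℝ) ≤ m)]
    have h2 : 0 < 1 / ((m : ℝ) + 2) := by positivity
    exact ae_le_dimH_graphOnCube hlam hα hαβ hT'm hV'm hV'c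
      (fun n => isUniform_congr (hT n) (hTT' n)) (fun n k => isUniform_congr (hV n k) (hVV' n k))
      hind' (by linarith) (by linarith)
  filter_upwards [key, ae_all_iff.2 hTT', ae_all_iff.2 fun n => ae_all_iff.2 (hVV' n)]
    with ω hω hTω hVω
  simp only [hTω, hVω]
  have hlim : Tendsto (fun m : ℕ => 1 - 1 / ((m : ℝ) + 2) + (1 - α / β)) atTop
      (𝓝 (1 - 0 + (1 - α / β))) := by
    refine (tendsto_const_nhds.sub ?_).add tendsto_const_nhds
    have := (tendsto_one_div_add_atTop_nhds_zero_nat (𝕜 := ℝ)).comp (tendsto_add_atTop_nat 1)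
    refine this.congr fun m => ?_
    simp only [Function.comp_apply]
    push_cast
    ring_nf
  have heq : 1 - 0 + (1 - α / β) = 2 - α / β := by ring
  rw [heq] at hlim
  exact le_of_tendsto' (ENNReal.tendsto_ofReal hlim) hω

end TakagiKnopp
end

/-! ### Conclusion -/

theorem mainTheorem3
    {Ω : Type*} [MeasurableSpace Ω] (P : MeasureTheory.Measure Ω)
    [MeasureTheory.IsProbabilityMeasure P]
    (D : ℕ) (lam α β : ℝ) (hlam : 1 < lam) (hα : 0 < α) (hαβ : α ≤ β) (hβ : β ≤ 1)
    (T : ℕ → Ω → TakagiKnopp.Space D)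
    (V : ℕ → (Fin D → ℤ) → Ω → TakagiKnopp.Space D)
    (hT : ∀ n, MeasureTheory.pdf.IsUniform (T n)
      (TakagiKnopp.openCube D (TakagiKnopp.meshSide D lam β n)) P MeasureTheory.volume)
    (hV : ∀ n k, MeasureTheory.pdf.IsUniform (V n k)
      (TakagiKnopp.openCube D (TakagiKnopp.meshSide D lam β n)) P MeasureTheory.volume)
    (hindep : ProbabilityTheory.iIndepFun
      (Sum.elim T (fun p : ℕ × (Fin D → ℤ) => V p.1 p.2)) P) :
    ∀ᵐ ω ∂P,
      (2 ≤ D →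
        TakagiKnopp.upperBoxDim (TakagiKnopp.graphOnCube
          (TakagiKnopp.series lam α β (fun n => T n ω) (fun n k => V n k ω)))
          ≤ (((D : ℝ) + 1 - α / β : ℝ) : EReal)) ∧
      (D = 1 →
        TakagiKnopp.upperBoxDim (TakagiKnopp.graphOnCube
          (TakagiKnopp.series lam α β (fun n => T n ω) (fun n k => V n k ω)))
          = ((2 - α / β : ℝ) : EReal) ∧
        dimH (TakagiKnopp.graphOnCube
          (TakagiKnopp.series lam α β (fun n => T n ω) (fun n k => V n k ω)))
          = ENNReal.ofReal (2 - α / β)) := by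
  have hmem : ∀ᵐ ω ∂P, ∀ n k, V n k ω ∈
      TakagiKnopp.openCube D (TakagiKnopp.meshSide D lam β n) :=
    MeasureTheory.ae_all_iff.2 fun n => MeasureTheory.ae_all_iff.2 fun k =>
      TakagiKnopp.ae_mem_openCube_of_isUniform (TakagiKnopp.meshSide_pos hlam D β n) (hV n k)
  by_cases hD : D = 1
  · subst hD
    filter_upwards [hmem, TakagiKnopp.ae_le_dimH_graphOnCube_series hlam hα hαβ hT hV hindep]
      with ω hω hlow
    refine ⟨fun h => absurd h (by norm_num), fun _ => ?_⟩
    set A := TakagiKnopp.graphOnCube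
      (TakagiKnopp.series lam α β (fun n => T n ω) (fun n k => V n k ω)) with hA
    have hup : TakagiKnopp.upperBoxDim A ≤ ((2 - α / β : ℝ) : EReal) := by
      have := TakagiKnopp.upperBoxDim_graphOnCube_series_le (t := fun n => T n ω) hlam hα hαβ hω
      have h2 : ((1 : ℕ) : ℝ) + 1 - α / β = 2 - α / β := by norm_num
      rwa [h2] at this
    have hne : A.Nonempty := ⟨_, 0, fun _ => by simp, rfl⟩
    have hdim := TakagiKnopp.dimH_le_upperBoxDim hne
    have hpos : 0 ≤ 2 - α / β := by
      have : α / β ≤ 1 := (div_le_one (by linarith)).2 hαβ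
      linarith
    have hcoe : ((ENNReal.ofReal (2 - α / β) : ENNReal) : EReal) = ((2 - α / β : ℝ) : EReal) := by
      rw [EReal.coe_ennreal_ofReal, max_eq_left hpos]
    have hlow' : ((2 - α / β : ℝ) : EReal) ≤ ((dimH A : ENNReal) : EReal) := by
      rw [← hcoe]
      exact EReal.coe_ennreal_le_coe_ennreal_iff.2 hlow
    refine ⟨le_antisymm hup (hlow'.trans hdim), le_antisymm ?_ hlow⟩
    rw [← EReal.coe_ennreal_le_coe_ennreal_iff, hcoe]
    exact hdim.trans hup
  -- The case `D = 0` also falls here, where both implications are vacuous.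
  · filter_upwards [hmem] with ω hω
    refine ⟨fun h => ?_, fun h => absurd h hD⟩
    have : NeZero D := ⟨by omega⟩
    exact TakagiKnopp.upperBoxDim_graphOnCube_series_le hlam hα hαβ hω
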